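/- For integers $d\ge 1$ and $0\le k\le d-1$ put $$\rho(d,k)=\frac12\left[\binom{\lceil d/2\rceil}{k}+\binom{\lfloor d/2\rfloor}{k}\right].$$ A $d$-polytope is the convex hull of finitely many points whose affine hull has dimension $d$, and $f_j(P)$ denotes the number of $j$-dimensional faces of $P$. For $n>d$, a cyclic polytope $C(d,n)$ is the convex hull of $n$ distinct points on the moment curve $t\mapsto(t,t^2,\dots,t^d)$ in $\mathbb R^d$ (for $d=1$ this is a segment). A polar dual of a full-dimensional polytope $Q\subset\mathbb R^d$ is a set $\{y\in\mathbb R^d:\langle x-z,y\rangle\le 1\text{ for all }x\in Q\}$, where $z$ is an interior point of $Q$. Theorem. Let $d\ge 1$ and $0\le k\le d-1$. (1) There are infinite families of (pairwise distinct) $d$-polytopes $(P_n)_{n>d}$ and $(Q_n)_{n>d}$ in $\mathbb R^d$ such that $Q_n$ is a cyclic polytope $C(d,n)$, $P_n$ is a polar dual of $Q_n$, and $$\lim_{n\to\infty}\frac{f_k(P_n)}{f_0(P_n)}=\rho(d,k),\qquad \lim_{n\to\infty}\frac{f_k(Q_n)}{f_{d-1}(Q_n)}=\rho(d,d-k-1).$$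 In particular, for every $\varepsilon>0$ and all sufficiently large $n$, $f_k(P_n)/f_0(P_n)<\rho(d,k)+\varepsilon$ and $f_k(Q_n)/f_{d-1}(Q_n)<\rho(d,d-k-1)+\varepsilon$. (2) Whenever, for each $n>d$, $Q_n$ is a cyclic polytope $C(d,n)$ (for any choice of the $n$ points on the moment curve) and $P_n$ is a polar dual of $Q_n$ (for any choice of the interior point), all $P_n$ and $Q_n$ are $d$-polytopes and the two limits in (1) hold. (3) Consequently the constants $\rho(d,k)$ and $\rho(d,d-k-1)$ in the linear lower bounds $f_k(P)\ge\rho(d,k)\,f_0(P)$ and $f_k(P)\ge\rho(d,d-k-1)\,f_{d-1}(P)$ for $d$-polytopes $P$ cannot be replaced by larger ones: if $c\in\mathbb R$ satisfies $f_k(P)\ge c\,f_0(P)$ for all $d$-polytopes $P\subset\mathbb R^d$, then $c\le\rho(d,k)$; and if $f_k(P)\ge c\,f_{d-1}(P)$ for all $d$-polytopes $P\subset\mathbb R^d$, then $c\le\rho(d,d-k-1)$. -/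

import Mathlib

open Filter Topology

/-- A `d`-polytope: the convex hull of finitely many points, nonempty, with affine hull of
dimension `d`. -/
def IsDPolytope {m : ℕ} (d : ℕ) (P : Set (EuclideanSpace ℝ (Fin m))) : Prop :=
  (∃ S : Set (EuclideanSpace ℝ (Fin m)), S.Finite ∧ P = convexHull ℝ S) ∧
    P.Nonempty ∧ Module.finrank ℝ (vectorSpan ℝ P) = d

/-- The set of `k`-dimensional faces of `P`. A nonempty face is the set of points of `P` at which
some linear functional attains its maximum over `P` (the zero functional gives `P` itself), that is,
`P` or the intersection of `P` with a supporting hyperplane. -/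
def kFaces {m : ℕ} (k : ℕ) (P : Set (EuclideanSpace ℝ (Fin m))) :
    Set (Set (EuclideanSpace ℝ (Fin m))) :=
  {F | F.Nonempty ∧ IsExposed ℝ P F ∧ Module.finrank ℝ (vectorSpan ℝ F) = k}

/-- The face number `f_k(P)`. -/
noncomputable def faceNumber {m : ℕ} (k : ℕ) (P : Set (EuclideanSpace ℝ (Fin m))) : ℕ :=
  (kFaces k P).ncard

/-- `ρ(d, k) = (binom(⌈d/2⌉, k) + binom(⌊d/2⌋, k)) / 2`; note that `(d + 1) / 2 = ⌈d/2⌉` and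
`d / 2 = ⌊d/2⌋` in the natural numbers. -/
noncomputable def rho (d k : ℕ) : ℝ :=
  (1 / 2) * ((Nat.choose ((d + 1) / 2) k : ℝ) + (Nat.choose (d / 2) k : ℝ))

/-- The moment curve `t ↦ (t, t², …, t^d)`. -/
noncomputable def momentCurve (d : ℕ) (t : ℝ) : EuclideanSpace ℝ (Fin d) :=
  WithLp.toLp 2 (fun i : Fin d => t ^ ((i : ℕ) + 1))

/-- `C` is a cyclic polytope `C(d, n)`: the convex hull of some `n` distinct points of the moment
curve in `ℝ^d` (used for `n > d`). -/
def IsCyclicPolytope (d n : ℕ) (C : Set (EuclideanSpace ℝ (Fin d))) : Prop :=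
  ∃ T : Finset ℝ, T.card = n ∧ C = convexHull ℝ (momentCurve d '' (T : Set ℝ))

/-- `P` is a polar dual of the full-dimensional polytope `Q`: the polar body of a translate
`Q - z` of `Q` that has the origin in its interior. -/
def IsPolarDual {d : ℕ} (Q P : Set (EuclideanSpace ℝ (Fin d))) : Prop :=
  ∃ z ∈ interior Q, P = {y | ∀ x ∈ Q, inner ℝ (x - z) y ≤ 1}

/-! An affine functional restricted to the moment curve is a polynomial of degree at most `d`, and
every such polynomial arises this way. Hence the faces of a cyclic polytope are cut out by
polynomials that are nonnegative at the `n` parameters, and a face is recorded by the set `W` of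
indices where its polynomial vanishes. This is Gale's evenness argument: a zero in the middle uses
up two roots, which serve one parameter or two neighbouring ones, while a zero at an end of the
parameter list may use up a single root. So `W` consists of blocks with `2 * B.card + E.card ≤ d`,
and conversely every such set is realised by an explicit product
(`IsZeroPattern.exists_blockDecomposition`, `IsBlockDecomposition.isZeroPattern`). Any `d + 1`
points of the curve are affinely independent, so `f_k` of a cyclic polytope counts the block sets
with `k + 1` elements (`kFaces_momentHull`), whatever the parameters are.

To count block sets with `j` elements for large `n`, put `m = d / 2`. Only configurations with `m`
blocks matter; their starting points can be chosen in about `n ^ m / m!` ways, and almost all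
choices are so spread out that `W` determines its blocks. The remaining choices, of end points and
of which blocks are pairs, number `blockCoeff d j = (1 + d % 2) * rho d (d - j)`. Dividing by the
case `j = d`, where `rho d 0 = 1`, gives the limit `rho d (d - j)`
(`tendsto_card_blockSets_div_card`).

Polarity reverses the face lattice, so `f_k(P) = f_{d-1-k}(Q)` (`IsPolarDual.faceNumber_eq`), and
both limits are instances of the same count: `j = k + 1` for `Q` and `j = d - k` for `P`. A limit of
ratios bounds every admissible constant `c`. -/

open Polynomial in
/-- `W` is the set of indices `i < n` at which some polynomial of degree at most `d`, nonnegative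
at `t 0, …, t (n - 1)`, vanishes. -/
def IsZeroPattern (t : ℕ → ℝ) (n d : ℕ) (W : Finset ℕ) : Prop :=
  ∃ q : ℝ[X], q.natDegree ≤ d ∧ ∀ i < n, 0 ≤ q.eval (t i) ∧ (q.eval (t i) = 0 ↔ i ∈ W)

/-- `W` is composed of end points `E`, and of singletons and pairs of neighbours starting at the
points of `B`, the pairs starting at the points of `A`. -/
structure IsBlockDecomposition (n d : ℕ) (W A B E : Finset ℕ) : Prop where
  subset : A ⊆ B
  left_subset : B ⊆ Finset.range n
  right_subset : A.image (· + 1) ⊆ Finset.range n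
  ends_subset : E ⊆ {0, n - 1}
  card_le : 2 * B.card + E.card ≤ d
  card_eq : A.card + B.card + E.card = W.card
  eq_union : W = B ∪ A.image (· + 1) ∪ E

/-! ### Zero patterns of nonnegative polynomials: Gale's evenness condition. -/

section Blocks

open Polynomial

theorem Polynomial.exists_eq_X_sub_C_mul {q : ℝ[X]} {a : ℝ} (hq : q ≠ 0) (ha : q.eval a = 0) :
    ∃ p : ℝ[X], q = (X - C a) * p ∧ p ≠ 0 ∧ q.natDegree = p.natDegree + 1 := by
  obtain ⟨p, rfl⟩ := dvd_iff_isRoot.2 ha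
  have hp : p ≠ 0 := right_ne_zero_of_mul hq
  refine ⟨p, rfl, hp, ?_⟩
  rw [natDegree_mul (X_sub_C_ne_zero a) hp, natDegree_X_sub_C, add_comm]

/-- Roots are divided out from left to right. Positivity at the fixed point `b` survives because
factors are removed in pairs, both negative at `b`; only a zero at the very last index may cost a
single root. The number `m` merely bounds the length of the recursion. -/
theorem exists_blocks_of_pos_left {t : ℕ → ℝ} (ht : StrictMono t) (n : ℕ) :
    ∀ (m a : ℕ), n ≤ a + m → ∀ (D : ℕ) (q : ℝ[X]) (b : ℝ), q.natDegree ≤ D → b < t a →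
      0 < q.eval b → (∀ i, a ≤ i → i < n → 0 ≤ q.eval (t i)) →
      ∃ A B E : Finset ℕ, A ⊆ B ∧ B ⊆ Finset.Ico a n ∧ E ⊆ {n - 1} ∧ 2 * B.card + E.card ≤ D ∧
        A.card + B.card + E.card = ((Finset.Ico a n).filter fun i => q.eval (t i) = 0).card ∧
        ((Finset.Ico a n).filter fun i => q.eval (t i) = 0) = B ∪ A.image (· + 1) ∪ E := by
  classical
  intro m
  induction m with
  | zero =>
    intro a ha D q b hD hb hqb hq
    have : Finset.Ico a n = ∅ := Finset.Ico_eq_empty (by omega)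
    exact ⟨∅, ∅, ∅, by simp [this]⟩
  | succ m ih =>
    intro a ha D q b hD hb hqb hq
    have hq0 : q ≠ 0 := by rintro rfl; simp at hqb
    rcases le_or_gt n a with hna | han
    · have : Finset.Ico a n = ∅ := Finset.Ico_eq_empty (by omega)
      exact ⟨∅, ∅, ∅, by simp [this]⟩
    have hta : t a < t (a + 1) := ht (Nat.lt_succ_self a)
    have hIco : Finset.Ico a n = insert a (Finset.Ico (a + 1) n) :=
      (Finset.insert_Ico_add_one_left_eq_Ico han).symm
    rcases (hq a le_rfl han).lt_or_eq with hpos | hzero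
    · obtain ⟨A, B, E, h1, h2, h3, h4, h5, h6⟩ := ih (a + 1) (by omega) D q b hD (hb.trans hta) hqb
        (fun i hi hin => hq i (by omega) hin)
      have hW : (Finset.Ico a n).filter (fun i => q.eval (t i) = 0) =
          (Finset.Ico (a + 1) n).filter (fun i => q.eval (t i) = 0) := by
        rw [hIco, Finset.filter_insert, if_neg hpos.ne']
      rw [hW]
      exact ⟨A, B, E, h1, h2.trans (Finset.Ico_subset_Ico_left (by omega)), h3, h4, h5, h6⟩
    obtain ⟨p, hqp, hp0, hpdeg⟩ := Polynomial.exists_eq_X_sub_C_mul hq0 hzero.symm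
    have hqe : ∀ x, q.eval x = (x - t a) * p.eval x := fun x => by rw [hqp]; simp
    have hpb : p.eval b < 0 := by
      have := hqe b
      by_contra hcon
      have : (b - t a) * p.eval b ≤ 0 :=
        mul_nonpos_of_nonpos_of_nonneg (by linarith) (not_lt.1 hcon)
      linarith
    rcases Nat.lt_or_ge (a + 1) n with hlt | hge
    swap
    · have hn : n = a + 1 := by omega
      subst hn
      have hW : (Finset.Ico a (a + 1)).filter (fun i => q.eval (t i) = 0) = {a} := by
        ext i
        simp only [Finset.mem_filter, Finset.mem_Ico, Finset.mem_singleton]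
        constructor
        · rintro ⟨h, -⟩; omega
        · rintro rfl; exact ⟨by omega, hzero.symm⟩
      rw [hW]
      exact ⟨∅, ∅, {a}, by simp, by simp, by simp, by simp; omega, by simp, by simp⟩
    -- Both cases below remove two roots `t a` and `r`. Since `r ≤ t (a + 1)`, the quotient has the
    -- same signs and zeros as `q` from index `a + 2` on.
    have key : ∀ (p₂ : ℝ[X]) (r : ℝ), (∀ x, q.eval x = (x - t a) * (x - r) * p₂.eval x) →
        r ≤ t (a + 1) → b < r → q.natDegree = p₂.natDegree + 2 →
        ∃ A B E : Finset ℕ, A ⊆ B ∧ B ⊆ Finset.Ico (a + 2) n ∧ E ⊆ {n - 1} ∧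
          2 * B.card + E.card ≤ D - 2 ∧
          A.card + B.card + E.card =
            ((Finset.Ico (a + 2) n).filter fun i => q.eval (t i) = 0).card ∧
          ((Finset.Ico (a + 2) n).filter fun i => q.eval (t i) = 0) = B ∪ A.image (· + 1) ∪ E := by
      intro p₂ r hp₂ hr hbr hdeg
      have hsign : ∀ i, a + 2 ≤ i → 0 < (t i - t a) * (t i - r) := fun i hi => by
        have h1 : t a < t i := ht (by omega)
        have h2 : t (a + 1) < t i := ht (by omega)
        exact mul_pos (by linarith) (by linarith)
      have hW : (Finset.Ico (a + 2) n).filter (fun i => q.eval (t i) = 0) =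
          (Finset.Ico (a + 2) n).filter (fun i => p₂.eval (t i) = 0) := by
        refine Finset.filter_congr fun i hi => ?_
        have := (hsign i (Finset.mem_Ico.1 hi).1).ne'
        rw [hp₂, mul_eq_zero, or_iff_right this]
      rw [hW]
      refine ih (a + 2) (by omega) (D - 2) p₂ b (by omega)
        (hb.trans (ht (by omega))) ?_ fun i hi hin => ?_
      · have h1 : 0 < (b - t a) * (b - r) := mul_pos_of_neg_of_neg (by linarith) (by linarith)
        rw [hp₂] at hqb
        exact (pos_iff_pos_of_mul_pos hqb).1 h1
      · have h1 := hsign i hi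
        have h2 := hq i (by omega) hin
        rw [hp₂] at h2
        exact nonneg_of_mul_nonneg_right h2 h1
    have hIco' : Finset.Ico a n = insert a (insert (a + 1) (Finset.Ico (a + 2) n)) := by
      rw [hIco, ← Finset.insert_Ico_add_one_left_eq_Ico hlt]; rfl
    have hnotB : ∀ {B : Finset ℕ}, B ⊆ Finset.Ico (a + 2) n → a ∉ B := fun hB h => by
      have := Finset.mem_Ico.1 (hB h); omega
    rcases (hq (a + 1) (by omega) hlt).lt_or_eq with hpos | hzero'
    · have hp1 : 0 < p.eval (t (a + 1)) := by
        rw [hqe] at hpos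
        exact (pos_iff_pos_of_mul_pos hpos).1 (by linarith)
      -- The quotient `p` changes sign between `b` and `t (a + 1)`, which yields the second root of
      -- a singleton block. It may lie on either side of `t a` or coincide with it.
      obtain ⟨r, ⟨hbr, hr⟩, hr0⟩ := intermediate_value_Ioo (hb.trans hta).le
        (p.continuous.continuousOn (s := Set.Icc b (t (a + 1)))) (Set.mem_Ioo.2 ⟨hpb, hp1⟩)
      obtain ⟨p₂, hpp, hp₂0, hp₂deg⟩ := Polynomial.exists_eq_X_sub_C_mul hp0 hr0
      obtain ⟨A, B, E, h1, h2, h3, h4, h5, h6⟩ := key p₂ r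
        (fun x => by rw [hqp, hpp]; simp; ring) hr.le hbr (by omega)
      have hW : (Finset.Ico a n).filter (fun i => q.eval (t i) = 0) =
          insert a ((Finset.Ico (a + 2) n).filter (fun i => q.eval (t i) = 0)) := by
        rw [hIco', Finset.filter_insert, if_pos hzero.symm, Finset.filter_insert,
          if_neg hpos.ne']
      refine ⟨A, insert a B, E, h1.trans (Finset.subset_insert _ _), ?_, h3, ?_, ?_, ?_⟩
      · exact Finset.insert_subset (by simp; omega)
          (h2.trans (Finset.Ico_subset_Ico_left (by omega)))
      · rw [Finset.card_insert_of_notMem (hnotB h2)]; omega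
      · rw [hW, Finset.card_insert_of_notMem (hnotB h2), Finset.card_insert_of_notMem (by simp),
          ← h5]
        omega
      · rw [hW, h6]; simp only [Finset.insert_union]
    · have hp1 : p.eval (t (a + 1)) = 0 := by
        rw [hqe] at hzero'
        exact (mul_eq_zero.1 hzero'.symm).resolve_left (by linarith)
      obtain ⟨p₂, hpp, hp₂0, hp₂deg⟩ := Polynomial.exists_eq_X_sub_C_mul hp0 hp1
      obtain ⟨A, B, E, h1, h2, h3, h4, h5, h6⟩ := key p₂ (t (a + 1))
        (fun x => by rw [hqp, hpp]; simp; ring) le_rfl (hb.trans hta) (by omega)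
      have hW : (Finset.Ico a n).filter (fun i => q.eval (t i) = 0) =
          insert a (insert (a + 1)
            ((Finset.Ico (a + 2) n).filter (fun i => q.eval (t i) = 0))) := by
        rw [hIco', Finset.filter_insert, if_pos hzero.symm, Finset.filter_insert,
          if_pos hzero'.symm]
      refine ⟨insert a A, insert a B, E, Finset.insert_subset_insert a h1, ?_, h3, ?_, ?_, ?_⟩
      · exact Finset.insert_subset (by simp; omega)
          (h2.trans (Finset.Ico_subset_Ico_left (by omega)))
      · rw [Finset.card_insert_of_notMem (hnotB h2)]; omega
      · rw [hW, Finset.card_insert_of_notMem (hnotB h2),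
          Finset.card_insert_of_notMem (hnotB (h1.trans h2)),
          Finset.card_insert_of_notMem (by simp), Finset.card_insert_of_notMem (by simp), ← h5]
        omega
      · rw [hW, h6, Finset.image_insert]
        ext i
        simp only [Finset.mem_insert, Finset.mem_union]
        tauto

theorem IsZeroPattern.exists_blockDecomposition {t : ℕ → ℝ} (ht : StrictMono t) {n d : ℕ}
    {W : Finset ℕ} (hW : W ⊆ Finset.range n) (hWn : W.card < n) (h : IsZeroPattern t n d W) :
    ∃ A B E, IsBlockDecomposition n d W A B E := by
  classical
  obtain ⟨q, hdeg, hq⟩ := h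
  have hfilter : ∀ a, (Finset.Ico a n).filter (fun i => q.eval (t i) = 0) =
      W.filter (fun i => a ≤ i) := by
    intro a
    ext i
    simp only [Finset.mem_filter, Finset.mem_Ico]
    constructor
    · rintro ⟨⟨h1, h2⟩, h3⟩; exact ⟨((hq i h2).2).1 h3, h1⟩
    · rintro ⟨h1, h2⟩
      have h3 := Finset.mem_range.1 (hW h1)
      exact ⟨⟨h2, h3⟩, ((hq i h3).2).2 h1⟩
  have hq0 : q ≠ 0 := by
    rintro rfl
    have : Finset.range n ⊆ W := fun i hi => ((hq i (Finset.mem_range.1 hi)).2).1 (by simp)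
    have := Finset.card_le_card this
    simp at this
    omega
  have hn : 0 < n := by omega
  have mk : ∀ A B E : Finset ℕ, A ⊆ B → B ⊆ Finset.range n → E ⊆ {0, n - 1} →
      2 * B.card + E.card ≤ d → A.card + B.card + E.card = W.card →
      W = B ∪ A.image (· + 1) ∪ E → ∃ A B E, IsBlockDecomposition n d W A B E :=
    fun A B E h1 h2 h3 h4 h5 h6 => ⟨A, B, E, h1, h2, fun x hx => hW (by
      rw [h6]; exact Finset.mem_union_left _ (Finset.mem_union_right _ hx)), h3, h4, h5, h6⟩
  have hE' : ∀ E : Finset ℕ, E ⊆ {n - 1} → E ⊆ {0, n - 1} := fun E hE =>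
    hE.trans (by simp)
  have hIco : ∀ a (B : Finset ℕ), B ⊆ Finset.Ico a n → B ⊆ Finset.range n := fun a B hB x hx =>
    Finset.mem_range.2 (Finset.mem_Ico.1 (hB hx)).2
  rcases ((hq 0 hn).1).lt_or_eq with hpos | hzero
  · obtain ⟨A, B, E, h1, h2, h3, h4, h5, h6⟩ := exists_blocks_of_pos_left ht n n 1 (by omega) d q
      (t 0) hdeg (ht (by omega)) hpos (fun i _ hi => (hq i hi).1)
    have hWW : W.filter (fun i => 1 ≤ i) = W := by
      refine Finset.filter_true_of_mem fun i hi => ?_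
      rcases Nat.eq_zero_or_pos i with rfl | h
      · exact absurd (((hq 0 hn).2).2 hi) hpos.ne'
      · exact h
    rw [hfilter, hWW] at h5 h6
    exact mk A B E h1 (hIco _ _ h2) (hE' _ h3) h4 h5 h6
  -- The sign of `q` left of `t 0` decides the role of index `0`: if negative, it is an end point
  -- costing one root; if positive, it starts an ordinary block.
  obtain ⟨b, hb, hbq⟩ : ∃ b, b < t 0 ∧ q.eval b ≠ 0 := by
    by_contra hcon
    push Not at hcon
    exact Set.Iio_infinite (t 0) ((q.roots.toFinset.finite_toSet).subset fun x hx => by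
      simpa [hq0] using hcon x hx)
  rcases lt_or_gt_of_ne hbq with hneg | hpos
  · obtain ⟨p, hqp, hp0, hpdeg⟩ := Polynomial.exists_eq_X_sub_C_mul hq0 hzero.symm
    have hqe : ∀ x, q.eval x = (x - t 0) * p.eval x := fun x => by rw [hqp]; simp
    have hsub : ∀ i, 1 ≤ i → 0 < t i - t 0 := fun i hi => sub_pos.2 (ht (by omega))
    obtain ⟨A, B, E, h1, h2, h3, h4, h5, h6⟩ := exists_blocks_of_pos_left ht n n 1 (by omega)
      (d - 1) p b (by omega) (hb.trans (ht (by omega))) (by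
        rw [hqe] at hneg
        by_contra hcon
        exact absurd hneg (not_lt.2 (mul_nonneg_of_nonpos_of_nonpos (by linarith) (not_lt.1 hcon))))
      (fun i h1i hi => by
        have := (hq i hi).1
        rw [hqe] at this
        exact nonneg_of_mul_nonneg_right this (hsub i h1i))
    have hpf : (Finset.Ico 1 n).filter (fun i => p.eval (t i) = 0) =
        W.filter (fun i => 1 ≤ i) := by
      rw [← hfilter]
      refine Finset.filter_congr fun i hi => ?_
      rw [hqe, mul_eq_zero, or_iff_right (hsub i (Finset.mem_Ico.1 hi).1).ne']
    rw [hpf] at h5 h6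
    have h0W : 0 ∈ W := ((hq 0 hn).2).1 hzero.symm
    have hWW : W = insert 0 (W.filter (fun i => 1 ≤ i)) := by
      ext i
      simp only [Finset.mem_insert, Finset.mem_filter]
      constructor
      · intro h
        rcases Nat.eq_zero_or_pos i with h0 | h0
        · exact Or.inl h0
        · exact Or.inr ⟨h, h0⟩
      · rintro (rfl | h)
        exacts [h0W, h.1]
    have h0E : 0 ∉ E := fun h => by
      have : 0 ∈ W.filter (fun i => 1 ≤ i) := by rw [h6]; exact Finset.mem_union_right _ h
      simp at this
    refine mk A B (insert 0 E) h1 (hIco _ _ h2) (Finset.insert_subset (by simp) (hE' _ h3)) ?_ ?_ ?_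
    · rw [Finset.card_insert_of_notMem h0E]; omega
    · rw [hWW, Finset.card_insert_of_notMem h0E, Finset.card_insert_of_notMem (by simp), ← h5]
      omega
    · rw [Finset.union_insert, ← h6]; exact hWW
  · obtain ⟨A, B, E, h1, h2, h3, h4, h5, h6⟩ := exists_blocks_of_pos_left ht n n 0 (by omega) d q
      b hdeg hb hpos (fun i _ hi => (hq i hi).1)
    have hWW : W.filter (fun i => 0 ≤ i) = W := Finset.filter_true_of_mem fun i _ => Nat.zero_le i
    rw [hfilter, hWW] at h5 h6
    exact mk A B E h1 (hIco _ _ h2) (hE' _ h3) h4 h5 h6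

/-- The witness is a product of one quadratic per block, with a double root or two neighbouring
roots, and one linear factor per end point. No parameter lies strictly between neighbours, so each
factor is nonnegative at all of them. -/
theorem IsBlockDecomposition.isZeroPattern {t : ℕ → ℝ} (ht : StrictMono t) {n d : ℕ}
    {W A B E : Finset ℕ} (h : IsBlockDecomposition n d W A B E) : IsZeroPattern t n d W := by
  classical
  obtain ⟨hAB, hBn, hAn, hE, hcard, -, hW⟩ := h
  let g : ℕ → ℝ[X] := fun i => (X - C (t i)) * (X - C (t (if i ∈ A then i + 1 else i)))
  let e : ℕ → ℝ[X] := fun i => if i = 0 then X - C (t 0) else C (t i) - X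
  have hdeg1 : ∀ x : ℝ, (X - C x : ℝ[X]).natDegree ≤ 1 := fun x => (natDegree_X_sub_C x).le
  have hg : ∀ i, (g i).natDegree ≤ 2 := fun i =>
    natDegree_mul_le.trans (add_le_add (hdeg1 _) (hdeg1 _))
  have he : ∀ i, (e i).natDegree ≤ 1 := fun i => by
    by_cases h0 : i = 0
    · simp only [e, if_pos h0]; exact hdeg1 _
    · simp only [e, if_neg h0]
      rw [← neg_sub, natDegree_neg]; exact hdeg1 _
  have hge : ∀ i k, 0 ≤ (g i).eval (t k) ∧
      ((g i).eval (t k) = 0 ↔ k = i ∨ (i ∈ A ∧ k = i + 1)) := by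
    intro i k
    by_cases hi : i ∈ A
    · simp only [g, if_true, eval_mul, eval_sub, eval_X, eval_C, mul_eq_zero, sub_eq_zero,
        ht.injective.eq_iff, hi, true_and]
      refine ⟨?_, trivial⟩
      rcases Nat.lt_or_ge i k with hk | hk
      · exact mul_nonneg (sub_nonneg.2 (ht.monotone hk.le)) (sub_nonneg.2 (ht.monotone hk))
      · exact mul_nonneg_of_nonpos_of_nonpos (sub_nonpos.2 (ht.monotone hk))
          (sub_nonpos.2 (ht.monotone (by omega)))
    · simp only [g, if_false, eval_mul, eval_sub, eval_X, eval_C, mul_eq_zero, sub_eq_zero,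
        ht.injective.eq_iff, hi, false_and, or_false, or_self]
      exact ⟨mul_self_nonneg _, trivial⟩
  have hee : ∀ i ∈ E, ∀ k < n, 0 ≤ (e i).eval (t k) ∧ ((e i).eval (t k) = 0 ↔ k = i) := by
    intro i hi k hk
    by_cases h0 : i = 0
    · subst h0
      simp only [e, if_true, eval_sub, eval_X, eval_C, sub_eq_zero, ht.injective.eq_iff,
        sub_nonneg, and_true]
      exact ht.monotone (Nat.zero_le k)
    · have hin : i = n - 1 := by
        have := hE hi
        simp only [Finset.mem_insert, Finset.mem_singleton] at this
        tauto
      simp only [e, if_neg h0, eval_sub, eval_X, eval_C, sub_eq_zero, ht.injective.eq_iff,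
        sub_nonneg]
      exact ⟨ht.monotone (by omega), eq_comm⟩
  refine ⟨(∏ i ∈ B, g i) * ∏ i ∈ E, e i, ?_, fun k hk => ?_⟩
  · refine natDegree_mul_le.trans (le_trans (add_le_add ?_ ?_) hcard)
    · refine (natDegree_prod_le _ _).trans ((Finset.sum_le_card_nsmul B _ 2 fun i _ => hg i).trans ?_)
      rw [smul_eq_mul, mul_comm]
    · refine (natDegree_prod_le _ _).trans ((Finset.sum_le_card_nsmul E _ 1 fun i _ => he i).trans ?_)
      rw [smul_eq_mul, mul_one]
  · rw [eval_mul, eval_prod, eval_prod]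
    refine ⟨mul_nonneg (Finset.prod_nonneg fun i _ => (hge i k).1)
      (Finset.prod_nonneg fun i hi => (hee i hi k hk).1), ?_⟩
    rw [mul_eq_zero, Finset.prod_eq_zero_iff, Finset.prod_eq_zero_iff, hW, Finset.mem_union,
      Finset.mem_union, Finset.mem_image]
    refine or_congr ⟨?_, ?_⟩ ⟨?_, ?_⟩
    · rintro ⟨i, hi, h⟩
      rcases (hge i k).2.1 h with rfl | ⟨hA, rfl⟩
      exacts [Or.inl hi, Or.inr ⟨i, hA, rfl⟩]
    · rintro (h | ⟨i, hA, rfl⟩)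
      · exact ⟨k, h, (hge k k).2.2 (Or.inl rfl)⟩
      · exact ⟨i, hAB hA, (hge i _).2.2 (Or.inr ⟨hA, rfl⟩)⟩
    · rintro ⟨i, hi, h⟩
      rw [((hee i hi k hk).2).1 h]; exact hi
    · intro h
      exact ⟨k, h, ((hee k h k hk).2).2 rfl⟩

end Blocks

/-! ### Asymptotic count of block sets. -/

section Counting

/-- The `m`-subsets of `{1, …, n - 3}` with all gaps at least `3`. -/
def sparseSets (n m : ℕ) : Finset (Finset ℕ) :=
  ((Finset.range n).powersetCard m).filter fun B =>
    (∀ p ∈ B, p ≠ 0 ∧ p ≠ n - 1 ∧ p ≠ n - 2) ∧ ∀ p ∈ B, p + 1 ∉ B ∧ p + 2 ∉ B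

theorem card_sparseSets_zero (n : ℕ) : (sparseSets n 0).card = 1 := by
  simp [sparseSets, Finset.filter_singleton]

/-- A set that is not sparse arises from an `m`-set by adding one of at most `2 * m + 3` forbidden
points: a successor, a second successor, or one of three boundary points. Such sets are therefore of
lower order in `n`. -/
theorem choose_le_card_sparseSets_succ (n m : ℕ) :
    n.choose (m + 1) ≤ (sparseSets n (m + 1)).card + n.choose m * (2 * m + 3) := by
  classical
  let N : Finset ℕ → Finset ℕ := fun B => B.image (· + 1) ∪ B.image (· + 2) ∪ {0, n - 1, n - 2}
  have hN : ∀ B, (N B).card ≤ 2 * B.card + 3 := fun B => by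
    have h1 : (B.image (· + 1)).card ≤ B.card := Finset.card_image_le
    have h2 : (B.image (· + 2)).card ≤ B.card := Finset.card_image_le
    have h3 : ({0, n - 1, n - 2} : Finset ℕ).card ≤ 3 := Finset.card_le_three
    have h4 := Finset.card_union_le (B.image (· + 1) ∪ B.image (· + 2)) {0, n - 1, n - 2}
    have h5 := Finset.card_union_le (B.image (· + 1)) (B.image (· + 2))
    simp only [N]
    omega
  have hsub : (Finset.range n).powersetCard (m + 1) ⊆ sparseSets n (m + 1) ∪
      ((Finset.range n).powersetCard m).biUnion fun B => (N B).image fun x => insert x B := by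
    intro B hB
    by_cases hs : B ∈ sparseSets n (m + 1)
    · exact Finset.mem_union_left _ hs
    refine Finset.mem_union_right _ ?_
    obtain ⟨hBn, hBc⟩ := Finset.mem_powersetCard.1 hB
    have key : ∀ x ∈ B, x ∈ N (B.erase x) →
        B ∈ ((Finset.range n).powersetCard m).biUnion fun B => (N B).image fun x => insert x B := by
      intro x hx hxN
      refine Finset.mem_biUnion.2 ⟨B.erase x, Finset.mem_powersetCard.2
        ⟨(Finset.erase_subset _ _).trans hBn, ?_⟩, Finset.mem_image.2 ⟨x, hxN, ?_⟩⟩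
      · rw [Finset.card_erase_of_mem hx]; omega
      · exact Finset.insert_erase hx
    simp only [sparseSets, Finset.mem_filter, hB, true_and, not_and_or, not_forall] at hs
    rcases hs with ⟨p, hp, hpe⟩ | ⟨p, hp, hpe⟩
    · refine key p hp ?_
      simp only [N, Finset.mem_union, Finset.mem_insert, Finset.mem_singleton]
      tauto
    · rcases hpe with h | h
      · refine key (p + 1) (not_not.1 h) ?_
        refine Finset.mem_union_left _ (Finset.mem_union_left _ (Finset.mem_image.2 ⟨p, ?_, rfl⟩))
        exact Finset.mem_erase.2 ⟨by omega, hp⟩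
      · refine key (p + 2) (not_not.1 h) ?_
        refine Finset.mem_union_left _ (Finset.mem_union_right _ (Finset.mem_image.2 ⟨p, ?_, rfl⟩))
        exact Finset.mem_erase.2 ⟨by omega, hp⟩
  have h := (Finset.card_le_card hsub).trans (Finset.card_union_le _ _)
  rw [Finset.card_powersetCard, Finset.card_range] at h
  refine h.trans (Nat.add_le_add_left ?_ _)
  have h2 := Finset.card_biUnion_le_card_mul ((Finset.range n).powersetCard m)
    (fun B => (N B).image fun x => insert x B) (2 * m + 3) (fun B hB => by
      have := hN B
      rw [(Finset.mem_powersetCard.1 hB).2] at this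
      exact Finset.card_image_le.trans this)
  rwa [Finset.card_powersetCard, Finset.card_range] at h2

theorem card_sparseSets_le (n m : ℕ) : (sparseSets n m).card ≤ n.choose m := by
  refine (Finset.card_filter_le _ _).trans ?_
  rw [Finset.card_powersetCard, Finset.card_range]

theorem tendsto_choose_div_pow_self (m : ℕ) :
    Tendsto (fun n : ℕ => (n.choose m : ℝ) / (n : ℝ) ^ m) atTop (𝓝 (1 / m.factorial)) := by
  have h := (isEquivalent_choose m)
  have hne : ∀ᶠ n : ℕ in atTop, ((n : ℝ) ^ m / m.factorial) ≠ 0 := by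
    filter_upwards [eventually_gt_atTop 0] with n hn
    have : (0 : ℝ) < n := by exact_mod_cast hn
    positivity
  have h2 := (Asymptotics.isEquivalent_iff_tendsto_one hne).1 h
  have h3 := h2.mul_const (1 / (m.factorial : ℝ))
  rw [one_mul] at h3
  refine h3.congr' ?_
  filter_upwards [eventually_gt_atTop 0] with n hn
  have : (0 : ℝ) < n := by exact_mod_cast hn
  have h4 : (m.factorial : ℝ) ≠ 0 := by positivity
  simp only [Pi.div_apply]
  field_simp

theorem tendsto_choose_div_pow_of_lt {b m : ℕ} (h : b < m) :
    Tendsto (fun n : ℕ => (n.choose b : ℝ) / (n : ℝ) ^ m) atTop (𝓝 0) := by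
  have h1 := (tendsto_choose_div_pow_self b).mul
    ((tendsto_pow_neg_atTop (𝕜 := ℝ) (n := m - b) (by omega)).comp tendsto_natCast_atTop_atTop)
  rw [mul_zero] at h1
  refine h1.congr' ?_
  filter_upwards [eventually_gt_atTop 0] with n hn
  have : (n : ℝ) ≠ 0 := by exact_mod_cast hn.ne'
  have hm : m = b + (m - b) := by omega
  simp only [Function.comp_apply, zpow_neg, zpow_natCast]
  rw [div_mul_eq_mul_div, ← div_eq_mul_inv, div_div, ← pow_add, add_comm, ← hm]

theorem tendsto_card_sparseSets_div_pow (m : ℕ) :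
    Tendsto (fun n : ℕ => ((sparseSets n m).card : ℝ) / (n : ℝ) ^ m) atTop
      (𝓝 (1 / m.factorial)) := by
  cases m with
  | zero => simp [card_sparseSets_zero]
  | succ m =>
    have hlow := (tendsto_choose_div_pow_self (m + 1)).sub
      ((tendsto_choose_div_pow_of_lt (Nat.lt_succ_self m)).mul_const (2 * m + 3 : ℝ))
    rw [zero_mul, sub_zero] at hlow
    refine tendsto_of_tendsto_of_tendsto_of_le_of_le hlow (tendsto_choose_div_pow_self (m + 1))
      (fun n => ?_) (fun n => ?_)
    · have h : (n.choose (m + 1) : ℝ) ≤ (sparseSets n (m + 1)).card + n.choose m * (2 * m + 3) := by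
        exact_mod_cast choose_le_card_sparseSets_succ n m
      simp only
      rw [div_mul_eq_mul_div, ← sub_div]
      gcongr
      linarith
    · simp only
      gcongr
      exact card_sparseSets_le n (m + 1)

open Classical in
/-- The sets with `j` elements that admit a block decomposition. -/
noncomputable def blockSets (n d j : ℕ) : Finset (Finset ℕ) :=
  ((Finset.range n).powersetCard j).filter fun W => ∃ A B E, IsBlockDecomposition n d W A B E

theorem mem_blockSets {n d j : ℕ} {W : Finset ℕ} : W ∈ blockSets n d j ↔
    (W ⊆ Finset.range n ∧ W.card = j) ∧ ∃ A B E, IsBlockDecomposition n d W A B E := by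
  simp only [blockSets, Finset.mem_filter, Finset.mem_powersetCard]

/-- A block set is the image of its triple `(E, B, A)`, and `card_eq` fixes the size of `A`.
Overcounting is harmless for an upper bound; the condition `b + E.card ≤ j` keeps the truncated
subtraction honest. -/
theorem card_blockSets_le (n d j : ℕ) :
    (blockSets n d j).card ≤ ∑ E ∈ ({0, n - 1} : Finset ℕ).powerset, ∑ b ∈ Finset.range (d / 2 + 1),
      if 2 * b + E.card ≤ d ∧ b + E.card ≤ j then n.choose b * b.choose (j - b - E.card) else 0 := by
  classical
  let X : Finset ℕ → ℕ → Finset (Finset ℕ × Finset ℕ) := fun E b =>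
    ((Finset.range n).powersetCard b).biUnion fun B =>
      (B.powersetCard (j - b - E.card)).image fun A => (A, B)
  have hX : ∀ E b, (X E b).card ≤ n.choose b * b.choose (j - b - E.card) := fun E b => by
    have h := Finset.card_biUnion_le_card_mul ((Finset.range n).powersetCard b)
      (fun B => (B.powersetCard (j - b - E.card)).image fun A => (A, B))
      (b.choose (j - b - E.card)) (fun B hB => by
        refine Finset.card_image_le.trans ?_
        rw [Finset.card_powersetCard, (Finset.mem_powersetCard.1 hB).2])
    rwa [Finset.card_powersetCard, Finset.card_range] at h
  have hsub : blockSets n d j ⊆ ({0, n - 1} : Finset ℕ).powerset.biUnion fun E =>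
      (Finset.range (d / 2 + 1)).biUnion fun b =>
        if 2 * b + E.card ≤ d ∧ b + E.card ≤ j then
          (X E b).image fun p => p.2 ∪ p.1.image (· + 1) ∪ E else ∅ := by
    intro W hW
    obtain ⟨⟨-, hj⟩, A, B, E, h⟩ := mem_blockSets.1 hW
    have h1 := h.card_le
    have h2 := h.card_eq
    refine Finset.mem_biUnion.2 ⟨E, Finset.mem_powerset.2 h.ends_subset,
      Finset.mem_biUnion.2 ⟨B.card, Finset.mem_range.2 (by omega), ?_⟩⟩
    rw [if_pos ⟨h1, by omega⟩]
    refine Finset.mem_image.2 ⟨(A, B), Finset.mem_biUnion.2 ⟨B, Finset.mem_powersetCard.2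
      ⟨h.left_subset, rfl⟩, Finset.mem_image.2 ⟨A, Finset.mem_powersetCard.2
      ⟨h.subset, by omega⟩, rfl⟩⟩, h.eq_union.symm⟩
  refine (Finset.card_le_card hsub).trans (Finset.card_biUnion_le.trans
    (Finset.sum_le_sum fun E _ => Finset.card_biUnion_le.trans (Finset.sum_le_sum fun b _ => ?_)))
  split_ifs
  · exact Finset.card_image_le.trans (hX E b)
  · simp

/-- For sparse `B` the triple can be read off from `W`: `E` is the part at the two ends, `B`
consists of the remaining elements without predecessor, and `A` of those elements of `B` that have a
successor. -/
theorem le_card_blockSets {n : ℕ} (hn0 : 0 < n) (d j m : ℕ) :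
    (∑ E ∈ ({0, n - 1} : Finset ℕ).powerset,
      if 2 * m + E.card ≤ d ∧ m + E.card ≤ j then
        (sparseSets n m).card * m.choose (j - m - E.card) else 0) ≤ (blockSets n d j).card := by
  classical
  rw [← Finset.sum_filter]
  let Y : Finset (Σ _ : Finset ℕ, Σ _ : Finset ℕ, Finset ℕ) :=
    (({0, n - 1} : Finset ℕ).powerset.filter fun E => 2 * m + E.card ≤ d ∧ m + E.card ≤ j).sigma
      fun E => (sparseSets n m).sigma fun B => B.powersetCard (j - m - E.card)
  have hY : Y.card = ∑ E ∈ ({0, n - 1} : Finset ℕ).powerset.filter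
      (fun E => 2 * m + E.card ≤ d ∧ m + E.card ≤ j),
        (sparseSets n m).card * m.choose (j - m - E.card) := by
    rw [Finset.card_sigma]
    refine Finset.sum_congr rfl fun E _ => ?_
    rw [Finset.card_sigma, Finset.sum_const_nat]
    intro B hB
    rw [Finset.card_powersetCard,
      (Finset.mem_powersetCard.1 (Finset.mem_filter.1 hB).1).2]
  have hmem : ∀ y ∈ Y, y.1 ⊆ {0, n - 1} ∧ 2 * m + y.1.card ≤ d ∧ m + y.1.card ≤ j ∧
      y.2.1 ⊆ Finset.range n ∧ y.2.1.card = m ∧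
      (∀ p ∈ y.2.1, (p ≠ 0 ∧ p ≠ n - 1 ∧ p ≠ n - 2) ∧ p + 1 ∉ y.2.1 ∧ p + 2 ∉ y.2.1) ∧
      y.2.2 ⊆ y.2.1 ∧ y.2.2.card = j - m - y.1.card := by
    intro y hy
    simp only [Y, Finset.mem_sigma, Finset.mem_filter, Finset.mem_powerset, sparseSets,
      Finset.mem_powersetCard] at hy
    obtain ⟨⟨h1, h2, h3⟩, ⟨⟨h4, h5⟩, h6, h7⟩, h8, h9⟩ := hy
    exact ⟨h1, h2, h3, h4, h5, fun p hp => ⟨h6 p hp, h7 p hp⟩, h8, h9⟩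
  let φ : (Σ _ : Finset ℕ, Σ _ : Finset ℕ, Finset ℕ) → Finset ℕ := fun y =>
    y.2.1 ∪ y.2.2.image (· + 1) ∪ y.1
  have hpE : ∀ y ∈ Y, ∀ p ∈ y.2.1, p ∉ y.1 ∧ p + 1 ∉ y.1 := by
    intro y hy p hp
    obtain ⟨h1, h2, h3, h4, h5, h6, h7, h8⟩ := hmem y hy
    obtain ⟨⟨q1, q2, q3⟩, -⟩ := h6 p hp
    constructor <;> intro h <;>
    · have := h1 h
      simp only [Finset.mem_insert, Finset.mem_singleton] at this
      omega
  rw [← hY]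
  refine Finset.card_le_card_of_injOn φ ?_ ?_
  · intro y hy
    obtain ⟨h1, h2, h3, h4, h5, h6, h7, h8⟩ := hmem y hy
    have hA : y.2.2.image (· + 1) ⊆ Finset.range n := by
      intro x hx
      obtain ⟨p, hp, rfl⟩ := Finset.mem_image.1 hx
      have hpn := Finset.mem_range.1 (h4 (h7 hp))
      have := (h6 p (h7 hp)).1
      exact Finset.mem_range.2 (by omega)
    have hcard : (φ y).card = y.2.2.card + y.2.1.card + y.1.card := by
      have hd1 : Disjoint y.2.1 (y.2.2.image (· + 1)) := by
        rw [Finset.disjoint_left]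
        intro x hx hx'
        obtain ⟨p, hp, rfl⟩ := Finset.mem_image.1 hx'
        exact (h6 p (h7 hp)).2.1 hx
      have hd2 : Disjoint (y.2.1 ∪ y.2.2.image (· + 1)) y.1 := by
        rw [Finset.disjoint_left]
        intro x hx hx'
        rcases Finset.mem_union.1 hx with hx | hx
        · exact (hpE y hy x hx).1 hx'
        · obtain ⟨p, hp, rfl⟩ := Finset.mem_image.1 hx
          exact (hpE y hy p (h7 hp)).2 hx'
      simp only [φ]
      rw [Finset.card_union_of_disjoint hd2, Finset.card_union_of_disjoint hd1,
        Finset.card_image_of_injective _ (add_left_injective 1)]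
      omega
    refine Finset.mem_coe.2 (mem_blockSets.2 ⟨⟨?_, by omega⟩,
      y.2.2, y.2.1, y.1, h7, h4, hA, h1, by omega, hcard.symm, rfl⟩)
    refine Finset.union_subset (Finset.union_subset h4 hA) (h1.trans ?_)
    intro x hx
    simp only [Finset.mem_insert, Finset.mem_singleton] at hx
    exact Finset.mem_range.2 (by omega)
  · have hE : ∀ y ∈ Y, y.1 = (φ y).filter (fun x => x = 0 ∨ x = n - 1) := by
      intro y hy
      obtain ⟨h1, h2, h3, h4, h5, h6, h7, h8⟩ := hmem y hy
      ext x
      simp only [φ, Finset.mem_filter, Finset.mem_union, Finset.mem_image]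
      constructor
      · intro hx
        have := h1 hx
        simp only [Finset.mem_insert, Finset.mem_singleton] at this
        exact ⟨Or.inr hx, this⟩
      · rintro ⟨(hx | ⟨p, hp, rfl⟩) | hx, h0⟩
        · have := (h6 x hx).1; omega
        · have := (h6 p (h7 hp)).1; omega
        · exact hx
    have hB : ∀ y ∈ Y, y.2.1 = (φ y \ y.1).filter (fun x => x - 1 ∉ φ y \ y.1) := by
      intro y hy
      obtain ⟨h1, h2, h3, h4, h5, h6, h7, h8⟩ := hmem y hy
      ext x
      simp only [φ, Finset.mem_filter, Finset.mem_union, Finset.mem_image, Finset.mem_sdiff]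
      constructor
      · intro hx
        have hx0 := (h6 x hx).1.1
        refine ⟨⟨Or.inl (Or.inl hx), (hpE y hy x hx).1⟩, ?_⟩
        rintro ⟨(hx' | ⟨p, hp, hpx⟩) | hx', h0⟩
        · refine (h6 _ hx').2.1 ?_
          rwa [Nat.sub_add_cancel (by omega)]
        · refine (h6 p (h7 hp)).2.2 ?_
          have : p + 2 = x := by omega
          rwa [this]
        · exact h0 hx'
      · rintro ⟨⟨(hx | ⟨p, hp, rfl⟩) | hx, h0⟩, hx'⟩
        · exact hx
        · refine absurd ⟨Or.inl (Or.inl ?_), ?_⟩ hx'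
          · exact h7 hp
          · exact (hpE y hy p (h7 hp)).1
        · exact absurd hx h0
    have hA : ∀ y ∈ Y, y.2.2 = y.2.1.filter (fun x => x + 1 ∈ φ y \ y.1) := by
      intro y hy
      obtain ⟨h1, h2, h3, h4, h5, h6, h7, h8⟩ := hmem y hy
      ext x
      simp only [φ, Finset.mem_filter, Finset.mem_union, Finset.mem_image, Finset.mem_sdiff]
      constructor
      · intro hx
        exact ⟨h7 hx, Or.inl (Or.inr ⟨x, hx, rfl⟩), (hpE y hy x (h7 hx)).2⟩
      · rintro ⟨hx, (hx' | ⟨p, hp, hpx⟩) | hx', h0⟩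
        · exact absurd hx' (h6 x hx).2.1
        · have : p = x := by omega
          rwa [← this]
        · exact absurd hx' h0
    rintro ⟨E, B, A⟩ hy ⟨E', B', A'⟩ hy' heq
    have e1 := hE _ hy
    rw [heq, ← hE _ hy'] at e1
    have e2 := hB _ hy
    rw [heq, e1, ← hB _ hy'] at e2
    have e3 := hA _ hy
    rw [heq, e1, e2, ← hA _ hy'] at e3
    simp only at e1 e2 e3
    subst e1 e2 e3
    rfl

/-- The number of choices of the end points and of the starting points of pairs, for given starting
points of `d / 2` blocks, that give a block decomposition of a `j`-set. -/
def blockCoeff (d j : ℕ) : ℕ :=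
  ∑ e ∈ Finset.range 3, Nat.choose 2 e *
    if 2 * (d / 2) + e ≤ d ∧ d / 2 + e ≤ j then (d / 2).choose (j - d / 2 - e) else 0

/-- For even `d` there is no room for an end point. For odd `d = 2m + 1` zero or one is possible,
and Pascal's rule turns `C(m, j-m) + 2 C(m, j-m-1)` into `C(m+1, j-m) + C(m, j-m-1)`; symmetry of
binomials does the rest. -/
theorem blockCoeff_eq {d j : ℕ} (hj : j ≤ d) :
    (blockCoeff d j : ℝ) = (1 + (d % 2 : ℕ)) * rho d (d - j) := by
  have hsymm : ∀ m a b : ℕ, m = a + b → m.choose a = m.choose b := fun m a b h =>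
    Nat.choose_symm_of_eq_add h
  have hadd : blockCoeff d j =
      (if 2 * (d / 2) ≤ d ∧ d / 2 ≤ j then (d / 2).choose (j - d / 2) else 0) +
      2 * (if 2 * (d / 2) + 1 ≤ d ∧ d / 2 + 1 ≤ j then (d / 2).choose (j - d / 2 - 1) else 0) := by
    have : ¬ (2 * (d / 2) + 2 ≤ d ∧ d / 2 + 2 ≤ j) := by omega
    simp [blockCoeff, Finset.sum_range_succ, this]
  obtain ⟨m, rfl | rfl⟩ := Nat.even_or_odd' d
  · have h1 : 2 * m / 2 = m := by omega
    have h2 : (2 * m + 1) / 2 = m := by omega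
    have h3 : blockCoeff (2 * m) j = m.choose (2 * m - j) := by
      have h4 : ¬ (2 * m + 1 ≤ 2 * m ∧ m + 1 ≤ j) := by omega
      rw [hadd, h1, if_neg h4]
      rcases Nat.lt_or_ge j m with h | h
      · have h5 : ¬ (2 * m ≤ 2 * m ∧ m ≤ j) := by omega
        rw [if_neg h5, Nat.choose_eq_zero_of_lt (by omega)]
      · have h5 : 2 * m ≤ 2 * m ∧ m ≤ j := by omega
        rw [if_pos h5, hsymm m _ (2 * m - j) (by omega), mul_zero, add_zero]
    rw [h3, rho, h1, h2, Nat.mul_mod_right]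
    push_cast
    ring
  · have h1 : (2 * m + 1) / 2 = m := by omega
    have h2 : (2 * m + 1 + 1) / 2 = m + 1 := by omega
    have h3 : blockCoeff (2 * m + 1) j =
        (m + 1).choose (2 * m + 1 - j) + m.choose (2 * m + 1 - j) := by
      rw [hadd, h1]
      rcases Nat.lt_or_ge j m with h | h
      · have h5 : ¬ (2 * m ≤ 2 * m + 1 ∧ m ≤ j) := by omega
        have h6 : ¬ (2 * m + 1 ≤ 2 * m + 1 ∧ m + 1 ≤ j) := by omega
        rw [if_neg h5, if_neg h6, Nat.choose_eq_zero_of_lt (n := m + 1) (by omega),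
          Nat.choose_eq_zero_of_lt (n := m) (by omega)]
      · have h5 : 2 * m ≤ 2 * m + 1 ∧ m ≤ j := by omega
        rw [if_pos h5, hsymm (m + 1) _ (j - m) (by omega)]
        rcases h.eq_or_lt with rfl | h
        · have h6 : ¬ (2 * m + 1 ≤ 2 * m + 1 ∧ m + 1 ≤ m) := by omega
          rw [if_neg h6, Nat.choose_eq_zero_of_lt (k := 2 * m + 1 - m) (by omega), Nat.sub_self]
          simp
        · have h6 : 2 * m + 1 ≤ 2 * m + 1 ∧ m + 1 ≤ j := by omega
          have h7 : j - m = j - m - 1 + 1 := by omega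
          rw [if_pos h6, h7, Nat.choose_succ_succ, Nat.add_sub_cancel,
            hsymm m (2 * m + 1 - j) (j - m - 1) (by omega)]
          simp only [Nat.succ_eq_add_one]
          ring
    have h4 : (2 * m + 1) % 2 = 1 := by omega
    rw [h3, rho, h1, h2, h4]
    push_cast
    ring

/-- A squeeze: the lower bound uses exactly `d / 2` sparse blocks, and in the upper bound the terms
with fewer blocks are negligible against `n ^ (d / 2)`. -/
theorem tendsto_card_blockSets_div_pow (d j : ℕ) :
    Tendsto (fun n : ℕ => ((blockSets n d j).card : ℝ) / (n : ℝ) ^ (d / 2)) atTop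
      (𝓝 (blockCoeff d j * (1 / (d / 2).factorial))) := by
  set m := d / 2 with hm
  have hcard : ∀ n : ℕ, 2 ≤ n → ({0, n - 1} : Finset ℕ).card = 2 := fun n hn =>
    Finset.card_pair (by omega)
  have hsum : ∀ n : ℕ, 2 ≤ n → ∀ f : ℕ → ℕ, ∑ E ∈ ({0, n - 1} : Finset ℕ).powerset, f E.card =
      ∑ e ∈ Finset.range 3, Nat.choose 2 e * f e := fun n hn f => by
    rw [Finset.sum_powerset_apply_card, hcard n hn]
    simp only [smul_eq_mul]
  have hlow : Tendsto (fun n : ℕ => ∑ e ∈ Finset.range 3, (Nat.choose 2 e : ℝ) *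
      ((if 2 * m + e ≤ d ∧ m + e ≤ j then m.choose (j - m - e) else 0 : ℕ) *
        (((sparseSets n m).card : ℝ) / (n : ℝ) ^ m))) atTop
      (𝓝 (blockCoeff d j * (1 / m.factorial))) := by
    have : (blockCoeff d j * (1 / m.factorial) : ℝ) = ∑ e ∈ Finset.range 3, (Nat.choose 2 e : ℝ) *
        ((if 2 * m + e ≤ d ∧ m + e ≤ j then m.choose (j - m - e) else 0 : ℕ) * (1 / m.factorial)) := by
      simp only [blockCoeff, Nat.cast_sum, Nat.cast_mul, Finset.sum_mul, mul_assoc, ← hm]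
    rw [this]
    exact tendsto_finsetSum _ fun e _ =>
      ((tendsto_card_sparseSets_div_pow m).const_mul _).const_mul _
  have hup : Tendsto (fun n : ℕ => ∑ e ∈ Finset.range 3, (Nat.choose 2 e : ℝ) *
      ∑ b ∈ Finset.range (m + 1), ((if 2 * b + e ≤ d ∧ b + e ≤ j then b.choose (j - b - e) else 0 : ℕ) *
        ((n.choose b : ℝ) / (n : ℝ) ^ m))) atTop
      (𝓝 (blockCoeff d j * (1 / m.factorial))) := by
    have : (blockCoeff d j * (1 / m.factorial) : ℝ) = ∑ e ∈ Finset.range 3, (Nat.choose 2 e : ℝ) *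
        ∑ b ∈ Finset.range (m + 1), ((if 2 * b + e ≤ d ∧ b + e ≤ j then b.choose (j - b - e) else 0 : ℕ) *
          (if b = m then 1 / m.factorial else 0 : ℝ)) := by
      simp only [blockCoeff, Nat.cast_sum, Nat.cast_mul, Finset.sum_mul, mul_assoc, ← hm]
      refine Finset.sum_congr rfl fun e _ => ?_
      simp only [mul_ite, mul_zero]
      rw [Finset.sum_ite_eq', if_pos (Finset.self_mem_range_succ m)]
    rw [this]
    refine tendsto_finsetSum _ fun e _ => (tendsto_finsetSum _ fun b hb => ?_).const_mul _
    refine Tendsto.const_mul _ ?_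
    split_ifs with h
    · rw [h]; exact tendsto_choose_div_pow_self m
    · exact tendsto_choose_div_pow_of_lt (by have := Finset.mem_range.1 hb; omega)
  refine tendsto_of_tendsto_of_tendsto_of_le_of_le' hlow hup ?_ ?_
  · filter_upwards [eventually_ge_atTop 2] with n hn
    have h := le_card_blockSets (n := n) (by omega) d j m
    rw [hsum n hn fun e => if 2 * m + e ≤ d ∧ m + e ≤ j then
      (sparseSets n m).card * m.choose (j - m - e) else 0] at h
    have h' : (∑ e ∈ Finset.range 3, (Nat.choose 2 e : ℝ) *
      ((if 2 * m + e ≤ d ∧ m + e ≤ j then m.choose (j - m - e) else 0 : ℕ) * ((sparseSets n m).card : ℝ))) ≤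
        (blockSets n d j).card := by
      refine le_trans (le_of_eq ?_) (Nat.cast_le.2 h)
      push_cast
      refine Finset.sum_congr rfl fun e _ => ?_
      split_ifs <;> simp [mul_comm]
    refine le_trans (le_of_eq ?_) (div_le_div_of_nonneg_right h' (by positivity))
    rw [Finset.sum_div]
    refine Finset.sum_congr rfl fun e _ => ?_
    ring
  · filter_upwards [eventually_ge_atTop 2] with n hn
    have h := card_blockSets_le n d j
    rw [hsum n hn fun e => ∑ b ∈ Finset.range (d / 2 + 1),
      if 2 * b + e ≤ d ∧ b + e ≤ j then n.choose b * b.choose (j - b - e) else 0] at h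
    have h' : ((blockSets n d j).card : ℝ) ≤ (∑ e ∈ Finset.range 3, (Nat.choose 2 e : ℝ) *
      ∑ b ∈ Finset.range (m + 1), ((if 2 * b + e ≤ d ∧ b + e ≤ j then b.choose (j - b - e) else 0 : ℕ) *
        (n.choose b : ℝ))) := by
      refine (Nat.cast_le.2 h).trans (le_of_eq ?_)
      push_cast
      refine Finset.sum_congr rfl fun e _ => congrArg _ (Finset.sum_congr rfl fun b _ => ?_)
      split_ifs <;> simp [mul_comm]
    refine (div_le_div_of_nonneg_right h' (by positivity)).trans (le_of_eq ?_)
    rw [Finset.sum_div]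
    refine Finset.sum_congr rfl fun e _ => ?_
    rw [mul_div_assoc, Finset.sum_div]
    simp only [mul_div_assoc]

end Counting

/-! ### Faces of cyclic polytopes. -/

section CyclicPolytope

theorem sep_convexHull_eq_convexHull_sep {E : Type*} [AddCommGroup E] [Module ℝ E] {V : Set E}
    (l : E →ₗ[ℝ] ℝ) {M : ℝ} (hM : ∀ v ∈ V, l v ≤ M) :
    {x ∈ convexHull ℝ V | l x = M} = convexHull ℝ {v ∈ V | l v = M} := by
  have hK : convexHull ℝ {v ∈ V | l v = M} ⊆ {x | l x = M} :=
    convexHull_min (fun v hv => hv.2) (convex_hyperplane l.isLinear M)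
  refine Set.Subset.antisymm ?_ (Set.subset_inter (convexHull_mono fun v hv => hv.1) hK)
  -- A convex combination with positive weights reaches `M` only if both points do, so this set is
  -- convex; it contains `V`, hence its hull.
  have hconv : Convex ℝ {x | l x < M ∨ x ∈ convexHull ℝ {v ∈ V | l v = M}} := by
    rw [convex_iff_forall_pos]
    intro x hx y hy a b ha hb hab
    have hle : ∀ z, z ∈ {x | l x < M ∨ x ∈ convexHull ℝ {v ∈ V | l v = M}} → l z ≤ M := by
      rintro z (hz | hz)
      exacts [hz.le, (hK hz).le]
    have hval : l (a • x + b • y) = a * l x + b * l y := by simp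
    have hMM : M = a * M + b * M := by rw [← add_mul, hab, one_mul]
    rcases hx with hx' | hx'
    · left
      have h1 := mul_lt_mul_of_pos_left hx' ha
      have h2 := mul_le_mul_of_nonneg_left (hle y hy) hb.le
      linarith
    rcases hy with hy' | hy'
    · left
      have h1 := mul_lt_mul_of_pos_left hy' hb
      have h2 := mul_le_mul_of_nonneg_left (hle x (Or.inr hx')) ha.le
      linarith
    · exact Or.inr (convex_convexHull ℝ _ hx' hy' ha.le hb.le hab)
  have hsub : convexHull ℝ V ⊆ {x | l x < M ∨ x ∈ convexHull ℝ {v ∈ V | l v = M}} :=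
    convexHull_min (fun v hv => (hM v hv).lt_or_eq.imp id fun h => subset_convexHull ℝ _ ⟨hv, h⟩)
      hconv
  rintro x ⟨hx, hxM⟩
  exact (hsub hx).resolve_left hxM.not_lt

theorem vectorSpan_convexHull_eq {E : Type*} [AddCommGroup E] [Module ℝ E] (V : Set E) :
    vectorSpan ℝ (convexHull ℝ V) = vectorSpan ℝ V := by
  rw [← direction_affineSpan, affineSpan_convexHull, direction_affineSpan]

open Polynomial

theorem exists_polynomial_eval_eq {d : ℕ} (l : EuclideanSpace ℝ (Fin d) →L[ℝ] ℝ) (M : ℝ) :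
    ∃ q : ℝ[X], q.natDegree ≤ d ∧ ∀ x, q.eval x = M - l (momentCurve d x) := by
  refine ⟨C M - ∑ i : Fin d, C (l (EuclideanSpace.single i 1)) * X ^ ((i : ℕ) + 1), ?_, fun x => ?_⟩
  · refine (natDegree_sub_le _ _).trans (max_le (by simp) ?_)
    exact natDegree_sum_le_of_forall_le _ _ fun i _ => (natDegree_C_mul_X_pow_le _ _).trans i.2
  · have h : momentCurve d x = ∑ i : Fin d, (x ^ ((i : ℕ) + 1)) • EuclideanSpace.single i (1 : ℝ) := by
      ext j
      simp [momentCurve, Pi.single_apply]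
    rw [h, map_sum]
    simp only [eval_sub, eval_C, eval_finsetSum, eval_mul, eval_pow, eval_X, map_smul, smul_eq_mul,
      mul_comm]

theorem exists_functional_eval_eq {d : ℕ} {q : ℝ[X]} (hq : q.natDegree ≤ d) :
    ∃ (l : EuclideanSpace ℝ (Fin d) →L[ℝ] ℝ) (M : ℝ), ∀ x, q.eval x = M - l (momentCurve d x) := by
  refine ⟨-∑ i : Fin d, q.coeff (i + 1) • EuclideanSpace.proj i, q.coeff 0, fun x => ?_⟩
  rw [eval_eq_sum_range' (Nat.lt_succ_of_le hq), Finset.sum_range_succ', add_comm]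
  simp [momentCurve, Finset.sum_range]

/-- The convex hull of the points with parameters `t i`, `i ∈ W`, of the moment curve. -/
def momentHull (d : ℕ) (t : ℕ → ℝ) (W : Finset ℕ) : Set (EuclideanSpace ℝ (Fin d)) :=
  convexHull ℝ ((fun i => momentCurve d (t i)) '' (W : Set ℕ))

theorem momentHull_mono {d : ℕ} {t : ℕ → ℝ} {W W' : Finset ℕ} (h : W ⊆ W') :
    momentHull d t W ⊆ momentHull d t W' :=
  convexHull_mono (Set.image_mono h)

theorem momentCurve_mem_momentHull {d : ℕ} {t : ℕ → ℝ} {W : Finset ℕ} {i : ℕ} (hi : i ∈ W) :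
    momentCurve d (t i) ∈ momentHull d t W :=
  subset_convexHull ℝ _ ⟨i, hi, rfl⟩

/-- Evaluating a dependence against the polynomial that vanishes at all nodes but one isolates a
single coefficient; the degree is at most `d` because there are at most `d + 1` nodes. -/
theorem affineIndependent_momentCurve {d : ℕ} {t : ℕ → ℝ} (ht : Function.Injective t)
    {W : Finset ℕ} (hW : W.card ≤ d + 1) :
    AffineIndependent ℝ (fun i : W => momentCurve d (t i)) := by
  classical
  rw [affineIndependent_iff]
  intro s w hw hs e he
  let q : ℝ[X] := ∏ i ∈ s.erase e, (X - C (t i))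
  have hq : q.natDegree ≤ d := by
    rw [natDegree_prod_of_monic _ _ fun i _ => monic_X_sub_C _]
    simp only [natDegree_X_sub_C, Finset.sum_const, smul_eq_mul, mul_one,
      Finset.card_erase_of_mem he]
    have : s.card ≤ W.card := (Finset.card_le_univ s).trans (by simp)
    omega
  obtain ⟨l, M, hl⟩ := exists_functional_eval_eq hq
  have h0 : ∑ i ∈ s, w i * q.eval (t i) = 0 := by
    have : ∑ i ∈ s, w i * q.eval (t i) =
        M * ∑ i ∈ s, w i - l (∑ i ∈ s, w i • momentCurve d (t i)) := by
      rw [map_sum, Finset.mul_sum, ← Finset.sum_sub_distrib]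
      refine Finset.sum_congr rfl fun i _ => ?_
      rw [hl, map_smul, smul_eq_mul]
      ring
    rw [this, hw, hs]
    simp
  rw [Finset.sum_eq_single_of_mem e he] at h0
  · refine (mul_eq_zero.1 h0).resolve_right ?_
    rw [eval_prod]
    refine Finset.prod_ne_zero_iff.2 fun i hi => ?_
    rw [eval_sub, eval_X, eval_C, sub_ne_zero]
    exact fun h => (Finset.mem_erase.1 hi).1 (Subtype.ext (ht h)).symm
  · intro i hi hie
    rw [eval_prod, Finset.prod_eq_zero (Finset.mem_erase.2 ⟨hie, hi⟩) (by simp), mul_zero]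

theorem finrank_vectorSpan_momentHull {d : ℕ} {t : ℕ → ℝ} (ht : Function.Injective t)
    {W : Finset ℕ} {k : ℕ} (hW : W.card = k + 1) (hk : k ≤ d) :
    Module.finrank ℝ (vectorSpan ℝ (momentHull d t W)) = k := by
  have h := (affineIndependent_momentCurve (d := d) ht (W := W) (by omega)).finrank_vectorSpan
    (n := k) (by simpa using hW)
  rw [momentHull, vectorSpan_convexHull_eq]
  rw [show (fun i => momentCurve d (t i)) '' (W : Set ℕ) =
    Set.range fun i : W => momentCurve d (t i) from by rw [Set.image_eq_range]; rfl]
  exact h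

theorem finrank_vectorSpan_momentHull_of_lt {d : ℕ} {t : ℕ → ℝ} (ht : Function.Injective t)
    {W : Finset ℕ} (hW : d < W.card) :
    Module.finrank ℝ (vectorSpan ℝ (momentHull d t W)) = d := by
  obtain ⟨W', hW', hcard⟩ := Finset.exists_subset_card_eq (Nat.succ_le_of_lt hW)
  refine le_antisymm ((Submodule.finrank_le _).trans (by simp)) ?_
  refine (finrank_vectorSpan_momentHull ht hcard le_rfl).ge.trans ?_
  exact Submodule.finrank_mono (vectorSpan_mono ℝ (momentHull_mono hW'))

theorem sep_momentHull_eq {d n : ℕ} {t : ℕ → ℝ} {W : Finset ℕ} (hW : W ⊆ Finset.range n)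
    {q : ℝ[X]} (hq : ∀ i < n, 0 ≤ q.eval (t i) ∧ (q.eval (t i) = 0 ↔ i ∈ W))
    {l : EuclideanSpace ℝ (Fin d) →L[ℝ] ℝ} {M : ℝ}
    (hl : ∀ x, q.eval x = M - l (momentCurve d x)) :
    (∀ x ∈ momentHull d t (Finset.range n), l x ≤ M) ∧
      {x ∈ momentHull d t (Finset.range n) | l x = M} = momentHull d t W := by
  have hV : ∀ v ∈ (fun i => momentCurve d (t i)) '' (Finset.range n : Set ℕ),
      l.toLinearMap v ≤ M := by
    rintro _ ⟨i, hi, rfl⟩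
    have := (hq i (by simpa using hi)).1
    rw [hl] at this
    simpa using this
  refine ⟨fun x hx => convexHull_min hV (convex_halfSpace_le l.toLinearMap.isLinear M) hx, ?_⟩
  have := sep_convexHull_eq_convexHull_sep l.toLinearMap hV
  refine this.trans (congrArg _ ?_)
  ext v
  simp only [Set.mem_ofPred_eq, Set.mem_image, Finset.mem_coe, ContinuousLinearMap.coe_coe]
  constructor
  · rintro ⟨⟨i, hi, rfl⟩, hv⟩
    refine ⟨i, ((hq i (by simpa using hi)).2).1 ?_, rfl⟩
    rw [hl, hv, sub_self]
  · rintro ⟨i, hi, rfl⟩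
    have hin := Finset.mem_range.1 (hW hi)
    refine ⟨⟨i, hW hi, rfl⟩, ?_⟩
    have := ((hq i hin).2).2 hi
    rw [hl] at this
    linarith

/-- A zero set with more than `d` elements spans all dimensions, so `k < d` forces the vertices of a
`k`-face to be affinely independent, and there are `k + 1` of them. -/
theorem kFaces_momentHull {d n k : ℕ} {t : ℕ → ℝ} (ht : StrictMono t) (hk : k < d) (hn : d < n) :
    kFaces k (momentHull d t (Finset.range n)) =
      momentHull d t '' (blockSets n d (k + 1) : Set (Finset ℕ)) := by
  classical
  ext F
  constructor
  · rintro ⟨⟨x₀, hx₀⟩, hexp, hdim⟩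
    obtain ⟨l, hF⟩ := hexp ⟨x₀, hx₀⟩
    obtain ⟨q, hqd, hq⟩ := exists_polynomial_eval_eq l (l x₀)
    rw [hF] at hx₀
    let W := (Finset.range n).filter fun i => q.eval (t i) = 0
    have hWn : W ⊆ Finset.range n := Finset.filter_subset _ _
    have hqW : ∀ i < n, 0 ≤ q.eval (t i) ∧ (q.eval (t i) = 0 ↔ i ∈ W) := fun i hi => by
      refine ⟨?_, by simp [W, hi]⟩
      rw [hq, sub_nonneg]
      exact hx₀.2 _ (momentCurve_mem_momentHull (Finset.mem_range.2 hi))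
    obtain ⟨hle, heq⟩ := sep_momentHull_eq hWn hqW hq
    have hFW : F = momentHull d t W := by
      rw [← heq, hF]
      ext x
      refine and_congr_right fun hx => ⟨fun h => le_antisymm (hle x hx) (h _ hx₀.1), fun h y hy => ?_⟩
      rw [h]
      exact hle y hy
    have hcard : W.card = k + 1 := by
      rcases Nat.lt_or_ge d W.card with h | h
      · rw [hFW, finrank_vectorSpan_momentHull_of_lt ht.injective h] at hdim
        omega
      · have hne : W.card ≠ 0 := fun h0 => by
          have : W = ∅ := Finset.card_eq_zero.1 h0
          rw [← hF, hFW, this] at hx₀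
          simp [momentHull] at hx₀
        rw [hFW, finrank_vectorSpan_momentHull ht.injective (k := W.card - 1) (by omega)
          (by omega)] at hdim
        omega
    refine ⟨W, Finset.mem_coe.2 (mem_blockSets.2 ⟨⟨hWn, hcard⟩, ?_⟩), hFW.symm⟩
    exact IsZeroPattern.exists_blockDecomposition ht hWn (by omega) ⟨q, hqd, hqW⟩
  · rintro ⟨W, hW, rfl⟩
    obtain ⟨⟨hWn, hcard⟩, A, B, E, h⟩ := mem_blockSets.1 (Finset.mem_coe.1 hW)
    obtain ⟨q, hqd, hq⟩ := h.isZeroPattern ht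
    obtain ⟨l, M, hl⟩ := exists_functional_eval_eq hqd
    obtain ⟨hle, heq⟩ := sep_momentHull_eq hWn hq hl
    obtain ⟨i, hi⟩ := Finset.card_pos.1 (by omega : 0 < W.card)
    have hmem := momentCurve_mem_momentHull (d := d) (t := t) hi
    refine ⟨⟨_, hmem⟩, fun _ => ⟨l, ?_⟩, finrank_vectorSpan_momentHull ht.injective hcard hk.le⟩
    rw [← heq] at hmem ⊢
    ext x
    refine and_congr_right fun hx => ⟨fun h y hy => h ▸ hle y hy, fun h => ?_⟩
    exact le_antisymm (hle x hx) (hmem.2 ▸ h _ hmem.1)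

theorem injOn_momentHull {d n j : ℕ} {t : ℕ → ℝ} (ht : StrictMono t) :
    Set.InjOn (momentHull d t) (blockSets n d j : Set (Finset ℕ)) := by
  have key : ∀ W ∈ blockSets n d j, ∀ W' ∈ blockSets n d j,
      momentHull d t W = momentHull d t W' → W ⊆ W' := by
    intro W hW W' hW' heq i hi
    have hin := Finset.mem_range.1 ((mem_blockSets.1 hW).1.1 hi)
    obtain ⟨⟨hWn', -⟩, A, B, E, h⟩ := mem_blockSets.1 hW'
    obtain ⟨q, hqd, hq⟩ := h.isZeroPattern ht
    obtain ⟨l, M, hl⟩ := exists_functional_eval_eq hqd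
    have hmem := momentCurve_mem_momentHull (d := d) (t := t) hi
    rw [heq, ← (sep_momentHull_eq hWn' hq hl).2] at hmem
    refine ((hq i hin).2).1 ?_
    rw [hl, hmem.2, sub_self]
  exact fun W hW W' hW' heq => Finset.Subset.antisymm (key W hW W' hW' heq)
    (key W' hW' W hW heq.symm)

theorem faceNumber_momentHull {d n k : ℕ} {t : ℕ → ℝ} (ht : StrictMono t) (hk : k < d)
    (hn : d < n) :
    faceNumber k (momentHull d t (Finset.range n)) = (blockSets n d (k + 1)).card := by
  rw [faceNumber, kFaces_momentHull ht hk hn, (injOn_momentHull ht).ncard_image,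
    Set.ncard_coe_finset]

/-- The enumeration is continued past the largest parameter, so that strict monotonicity holds on
all of `ℕ`. -/
theorem Finset.exists_strictMono_image_range_eq (T : Finset ℝ) :
    ∃ t : ℕ → ℝ, StrictMono t ∧ (Finset.range T.card).image t = T := by
  classical
  obtain ⟨M, hM⟩ := T.bddAbove
  have hM' : ∀ x ∈ T, x ≤ M := fun x hx => hM hx
  let e := T.orderEmbOfFin rfl
  refine ⟨fun i => if h : i < T.card then e ⟨i, h⟩ else M + i + 1, fun i k hik => ?_, ?_⟩
  · simp only
    split_ifs with h1 h2 h2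
    · exact e.strictMono hik
    · have := hM' _ (T.orderEmbOfFin_mem rfl ⟨i, h1⟩)
      have : (0 : ℝ) ≤ k := Nat.cast_nonneg k
      simp only [e]
      linarith
    · omega
    · have : (i : ℝ) < k := by exact_mod_cast hik
      linarith
  · ext x
    simp only [Finset.mem_image, Finset.mem_range]
    constructor
    · rintro ⟨i, hi, rfl⟩
      rw [dif_pos hi]
      exact T.orderEmbOfFin_mem rfl _
    · intro hx
      have : x ∈ Set.range e := by simpa [e] using hx
      obtain ⟨i, rfl⟩ := this
      exact ⟨i, i.2, by rw [dif_pos i.2]⟩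

theorem IsCyclicPolytope.exists_momentHull {d n : ℕ} {Q : Set (EuclideanSpace ℝ (Fin d))}
    (h : IsCyclicPolytope d n Q) : ∃ t : ℕ → ℝ, StrictMono t ∧
      Q = momentHull d t (Finset.range n) := by
  obtain ⟨T, rfl, rfl⟩ := h
  obtain ⟨t, ht, hT⟩ := T.exists_strictMono_image_range_eq
  refine ⟨t, ht, ?_⟩
  rw [momentHull, ← Set.image_image (momentCurve d) t, ← Finset.coe_image (f := t), hT]

theorem IsCyclicPolytope.isDPolytope {d n : ℕ} {Q : Set (EuclideanSpace ℝ (Fin d))}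
    (h : IsCyclicPolytope d n Q) (hn : d < n) : IsDPolytope d Q := by
  obtain ⟨t, ht, rfl⟩ := h.exists_momentHull
  refine ⟨⟨_, (Finset.finite_toSet _).image _, rfl⟩,
    ⟨_, momentCurve_mem_momentHull (Finset.mem_range.2 (by omega : 0 < n))⟩,
    finrank_vectorSpan_momentHull_of_lt ht.injective (by simpa using hn)⟩

theorem IsCyclicPolytope.faceNumber_eq {d n k : ℕ} {Q : Set (EuclideanSpace ℝ (Fin d))}
    (h : IsCyclicPolytope d n Q) (hk : k < d) (hn : d < n) :
    faceNumber k Q = (blockSets n d (k + 1)).card := by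
  obtain ⟨t, ht, rfl⟩ := h.exists_momentHull
  exact faceNumber_momentHull ht hk hn

end CyclicPolytope

/-! ### Translation invariance of face numbers. -/

section Translation

open Pointwise

variable {m : ℕ}

theorem vadd_mem_kFaces {k : ℕ} {P F : Set (EuclideanSpace ℝ (Fin m))}
    (w : EuclideanSpace ℝ (Fin m)) (hF : F ∈ kFaces k P) : w +ᵥ F ∈ kFaces k (w +ᵥ P) := by
  obtain ⟨hne, hexp, hdim⟩ := hF
  obtain ⟨l, rfl⟩ := hexp hne
  refine ⟨hne.vadd_set, fun _ => ⟨l, ?_⟩, ?_⟩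
  · ext x
    simp only [Set.mem_vadd_set, Set.mem_ofPred_eq]
    constructor
    · rintro ⟨y, ⟨hy, h⟩, rfl⟩
      refine ⟨⟨y, hy, rfl⟩, ?_⟩
      rintro _ ⟨y', hy', rfl⟩
      simpa using h y' hy'
    · rintro ⟨⟨y, hy, rfl⟩, h⟩
      exact ⟨y, ⟨hy, fun y' hy' => by simpa using h _ ⟨y', hy', rfl⟩⟩, rfl⟩
  · rw [vectorSpan_vadd]; exact hdim

theorem faceNumber_vadd (k : ℕ) (P : Set (EuclideanSpace ℝ (Fin m)))
    (w : EuclideanSpace ℝ (Fin m)) : faceNumber k (w +ᵥ P) = faceNumber k P := by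
  have : kFaces k (w +ᵥ P) = (w +ᵥ ·) '' kFaces k P := by
    ext F
    constructor
    · intro hF
      refine ⟨-w +ᵥ F, ?_, vadd_neg_vadd w F⟩
      simpa using vadd_mem_kFaces (-w) hF
    · rintro ⟨F, hF, rfl⟩
      exact vadd_mem_kFaces w hF
  rw [faceNumber, this, Set.ncard_image_of_injective _ (AddAction.injective w), faceNumber]

end Translation

/-! ### Polarity and the reversal of the face lattice. -/

section Duality

variable {E : Type*} [NormedAddCommGroup E] [InnerProductSpace ℝ E]

/-- `A` and `B` are the polar bodies of each other, and neighbourhoods of the origin. -/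
structure IsPolarPair (A B : Set E) : Prop where
  left_eq : A = {y | ∀ x ∈ B, inner ℝ x y ≤ 1}
  right_eq : B = {x | ∀ y ∈ A, inner ℝ y x ≤ 1}
  zero_mem_left : (0 : E) ∈ interior A
  zero_mem_right : (0 : E) ∈ interior B

/-- The part of `B` on which all functionals given by the points of `F` have the value `1`. -/
def polarFace (B F : Set E) : Set E := {x ∈ B | ∀ y ∈ F, inner ℝ y x = 1}

namespace IsPolarPair

variable {A B F : Set E}

theorem symm (h : IsPolarPair A B) : IsPolarPair B A :=
  ⟨h.right_eq, h.left_eq, h.zero_mem_right, h.zero_mem_left⟩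

theorem inner_le_one (h : IsPolarPair A B) {y x : E} (hy : y ∈ A) (hx : x ∈ B) :
    inner ℝ y x ≤ 1 := by
  rw [h.right_eq] at hx
  exact hx y hy

theorem convex_left (h : IsPolarPair A B) : Convex ℝ A := by
  rw [h.left_eq]
  intro y hy y' hy' a b ha hb hab x hx
  rw [inner_add_right, real_inner_smul_right, real_inner_smul_right]
  have h1 := mul_le_mul_of_nonneg_left (hy x hx) ha
  have h2 := mul_le_mul_of_nonneg_left (hy' x hx) hb
  linarith

theorem exists_eq_of_isExposed [CompleteSpace E] (h : IsPolarPair A B) (hF : IsExposed ℝ A F)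
    (hne : F.Nonempty) (hFA : F ≠ A) : ∃ c ∈ B, F = {y ∈ A | inner ℝ c y = 1} := by
  obtain ⟨l, hl⟩ := hF hne
  obtain ⟨y₀, hy₀⟩ := hne
  rw [hl] at hy₀
  have hl0 : ∃ u, 0 < l u := by
    by_contra hcon
    push Not at hcon
    have hz : ∀ u, l u = 0 := fun u => le_antisymm (hcon u) (by simpa using hcon (-u))
    exact hFA (hl.trans (by simp [hz]))
  obtain ⟨u, hu⟩ := hl0
  -- The origin is interior to `A`, so a nonzero functional has positive maximum and can be rescaled
  -- to have maximum `1`; it is then given by a point of `B`.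
  have hM : 0 < l y₀ := by
    have hev : ∀ᶠ ε : ℝ in 𝓝 0, ε • u ∈ A := by
      have hc : Continuous fun ε : ℝ => ε • u := by fun_prop
      have := hc.tendsto 0
      rw [zero_smul] at this
      exact this (mem_interior_iff_mem_nhds.1 h.zero_mem_left)
    obtain ⟨ε, hε, hεA⟩ := ((hev.filter_mono nhdsWithin_le_nhds).and
      (self_mem_nhdsWithin : Set.Ioi (0 : ℝ) ∈ 𝓝[>] 0)).exists
    have := hy₀.2 _ hε
    rw [map_smul, smul_eq_mul] at this
    exact (mul_pos hεA hu).trans_le this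
  let c : E := (l y₀)⁻¹ • (InnerProductSpace.toDual ℝ E).symm l
  have hc : ∀ y, inner ℝ c y = (l y₀)⁻¹ * l y := fun y => by
    simp only [c]
    rw [real_inner_smul_left, InnerProductSpace.toDual_symm_apply]
  refine ⟨c, ?_, ?_⟩
  · rw [h.right_eq]
    intro y hy
    rw [real_inner_comm, hc, inv_mul_le_one₀ hM]
    exact hy₀.2 y hy
  · rw [hl]
    ext y
    refine and_congr_right fun hy => ?_
    rw [hc, inv_mul_eq_one₀ hM.ne']
    exact ⟨fun h' => le_antisymm (h' _ hy₀.1) (hy₀.2 y hy), fun h' z hz => h' ▸ hy₀.2 z hz⟩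

theorem isExposed_setOf_inner_eq_one (h : IsPolarPair A B) {c : E} (hc : c ∈ B) :
    IsExposed ℝ A {y ∈ A | inner ℝ c y = 1} := by
  rintro ⟨y₀, hy₀, hcy₀⟩
  refine ⟨innerSL ℝ c, ?_⟩
  have hle : ∀ y ∈ A, inner ℝ c y ≤ 1 := fun y hy => h.symm.inner_le_one hc hy
  ext y
  simp only [Set.mem_ofPred_eq, innerSL_apply_apply]
  refine and_congr_right fun hy => ⟨fun h' z hz => h' ▸ hle z hz, fun h' => ?_⟩
  exact le_antisymm (hle y hy) (hcy₀ ▸ h' y₀ hy₀)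

/-- `F` is a nonempty face of `A` cut out by a point of the polar body `B`. -/
structure IsProperFace (A B F : Set E) : Prop where
  nonempty : F.Nonempty
  exists_eq : ∃ c ∈ B, F = {y ∈ A | inner ℝ c y = 1}

theorem isProperFace_of_isExposed [CompleteSpace E] (h : IsPolarPair A B) (hF : IsExposed ℝ A F)
    (hne : F.Nonempty) (hFA : F ≠ A) : IsProperFace A B F :=
  ⟨hne, h.exists_eq_of_isExposed hF hne hFA⟩

theorem IsProperFace.isExposed (h : IsPolarPair A B) (hF : IsProperFace A B F) :
    IsExposed ℝ A F := by
  obtain ⟨c, hc, rfl⟩ := hF.exists_eq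
  exact h.isExposed_setOf_inner_eq_one hc

theorem IsProperFace.subset (hF : IsProperFace A B F) : F ⊆ A := by
  obtain ⟨c, hc, rfl⟩ := hF.exists_eq
  exact Set.sep_subset _ _

theorem IsProperFace.convex (h : IsPolarPair A B) (hF : IsProperFace A B F) : Convex ℝ F := by
  obtain ⟨c, hc, rfl⟩ := hF.exists_eq
  exact h.convex_left.inter (convex_hyperplane (innerSL ℝ c).toLinearMap.isLinear 1)

/-- The point `c` that cuts out `F` itself belongs to the polar face, so no point outside `F`
survives the second polarity. -/
theorem IsProperFace.polarFace_polarFace (hF : IsProperFace A B F) :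
    polarFace A (polarFace B F) = F := by
  have hsub := hF.subset
  refine Set.Subset.antisymm ?_ fun y hy => ⟨hsub hy, fun x hx => ?_⟩
  · obtain ⟨c, hc, rfl⟩ := hF.exists_eq
    exact fun y hy => ⟨hy.1, hy.2 c ⟨hc, fun z hz => by rw [real_inner_comm]; exact hz.2⟩⟩
  · rw [real_inner_comm]; exact hx.2 y hy

theorem IsProperFace.nonempty_polarFace (hF : IsProperFace A B F) : (polarFace B F).Nonempty := by
  obtain ⟨c, hc, rfl⟩ := hF.exists_eq
  exact ⟨c, hc, fun z hz => by rw [real_inner_comm]; exact hz.2⟩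

/-- A point in the relative interior of a convex set detects functionals constant on the set. -/
theorem _root_.Convex.exists_forall_inner_eq_one [FiniteDimensional ℝ E] (hF : Convex ℝ F)
    (hne : F.Nonempty) : ∃ y₀ ∈ F, ∀ x, (∀ y ∈ F, inner ℝ y x ≤ 1) → inner ℝ y₀ x = 1 →
      ∀ y ∈ F, inner ℝ y x = 1 := by
  obtain ⟨y₀, hy₀⟩ := hne.intrinsicInterior hF
  refine ⟨y₀, intrinsicInterior_subset hy₀, fun x hx hx₀ y hy => le_antisymm (hx y hy) ?_⟩
  obtain ⟨p, hp, hpy⟩ := mem_intrinsicInterior.1 hy₀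
  let g : ℝ → affineSpan ℝ F := fun ε => ⟨AffineMap.lineMap y₀ y ε, AffineMap.lineMap_mem ε
    (subset_affineSpan ℝ F (intrinsicInterior_subset hy₀)) (subset_affineSpan ℝ F hy)⟩
  have hg : Continuous g := by
    refine Continuous.subtype_mk ?_ _
    exact AffineMap.lineMap_continuous
  have hg0 : g 0 = p := Subtype.ext (by simp [g, hpy])
  have hev : ∀ᶠ ε : ℝ in 𝓝 0, AffineMap.lineMap y₀ y ε ∈ F := by
    have := hg.tendsto 0
    rw [hg0] at this
    exact this (mem_interior_iff_mem_nhds.1 hp)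
  -- A negative `ε` moves past `y₀` away from `y`, where the functional would exceed `1` if it were
  -- smaller than `1` at `y`.
  obtain ⟨ε, hε, hε0⟩ := ((hev.filter_mono nhdsWithin_le_nhds).and
    (self_mem_nhdsWithin : Set.Iio (0 : ℝ) ∈ 𝓝[<] 0)).exists
  have h1 := hx _ hε
  rw [AffineMap.lineMap_apply_module', inner_add_left, real_inner_smul_left, inner_sub_left,
    hx₀] at h1
  have hε0' : ε < 0 := hε0
  by_contra hcon
  have : 0 < ε * (inner ℝ y x - 1) := mul_pos_of_neg_of_neg hε0' (by linarith)
  linarith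

theorem IsProperFace.exists_polarFace_eq [FiniteDimensional ℝ E] (h : IsPolarPair A B)
    (hF : IsProperFace A B F) : ∃ y₀ ∈ F, polarFace B F = {x ∈ B | inner ℝ y₀ x = 1} := by
  obtain ⟨y₀, hy₀, hy₀F⟩ := (hF.convex h).exists_forall_inner_eq_one hF.nonempty
  refine ⟨y₀, hy₀, Set.Subset.antisymm (fun x hx => ⟨hx.1, hx.2 y₀ hy₀⟩) fun x hx => ⟨hx.1, ?_⟩⟩
  exact hy₀F x (fun y hy => h.inner_le_one (hF.subset hy) hx.1) hx.2

theorem IsProperFace.polarFace [FiniteDimensional ℝ E] (h : IsPolarPair A B)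
    (hF : IsProperFace A B F) : IsProperFace B A (polarFace B F) := by
  obtain ⟨y₀, hy₀, heq⟩ := hF.exists_polarFace_eq h
  exact ⟨hF.nonempty_polarFace, y₀, hF.subset hy₀, heq⟩

end IsPolarPair

/-- Constraints active at `y` are unaffected by `u`; the finitely many others are slack and stay so
for small `ε`. -/
theorem Set.Finite.eventually_add_smul_mem {V A : Set E} (hV : V.Finite)
    (hA : A = {y | ∀ v ∈ V, inner ℝ v y ≤ 1}) {y u : E} (hy : y ∈ A)
    (hu : ∀ v ∈ V, inner ℝ v y = 1 → inner ℝ v u = 0) : ∀ᶠ ε : ℝ in 𝓝 0, y + ε • u ∈ A := by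
  subst hA
  simp only [Set.mem_ofPred_eq]
  rw [hV.eventually_all]
  intro v hv
  rcases (hy v hv).lt_or_eq with hlt | heq
  · have hc : Continuous fun ε : ℝ => inner ℝ v (y + ε • u) := by fun_prop
    have := hc.tendsto 0
    rw [zero_smul, add_zero] at this
    filter_upwards [this.eventually_lt_const hlt] with ε hε using hε.le
  · refine Eventually.of_forall fun ε => ?_
    rw [inner_add_right, real_inner_smul_right, hu v hv heq, heq]
    simp

theorem finrank_span_eq_finrank_vectorSpan_add_one [FiniteDimensional ℝ E] {S : Set E}
    (hS : S.Nonempty) {y₀ : E} (hy₀ : ∀ x ∈ S, inner ℝ y₀ x = 1) :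
    Module.finrank ℝ (Submodule.span ℝ S) = Module.finrank ℝ (vectorSpan ℝ S) + 1 := by
  obtain ⟨s, hs⟩ := hS
  have hs0 : s ≠ 0 := by
    rintro rfl
    simpa using hy₀ 0 hs
  have hker : ∀ v ∈ vectorSpan ℝ S, inner ℝ y₀ v = 0 := by
    intro v hv
    have : vectorSpan ℝ S ≤ LinearMap.ker (innerSL ℝ y₀).toLinearMap := by
      rw [vectorSpan_def, Submodule.span_le]
      rintro _ ⟨a, ha, b, hb, rfl⟩
      simp [inner_sub_right, hy₀ a ha, hy₀ b hb]
    simpa using this hv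
  have hsup : Submodule.span ℝ S = vectorSpan ℝ S ⊔ Submodule.span ℝ {s} := by
    refine le_antisymm (Submodule.span_le.2 fun x hx => ?_) (sup_le ?_ ?_)
    · have : x = (x -ᵥ s) + s := by simp
      rw [this]
      exact Submodule.add_mem_sup (vsub_mem_vectorSpan ℝ hx hs) (Submodule.mem_span_singleton_self s)
    · rw [vectorSpan_def, Submodule.span_le]
      rintro _ ⟨a, ha, b, hb, rfl⟩
      exact Submodule.sub_mem _ (Submodule.subset_span ha) (Submodule.subset_span hb)
    · exact Submodule.span_mono (by simpa using hs)
  have hinf : vectorSpan ℝ S ⊓ Submodule.span ℝ {s} = ⊥ := by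
    rw [eq_bot_iff]
    rintro x ⟨hx1, hx2⟩
    obtain ⟨a, rfl⟩ := Submodule.mem_span_singleton.1 hx2
    have := hker _ hx1
    rw [real_inner_smul_right, hy₀ s hs, mul_one] at this
    simp [this]
  have := Submodule.finrank_sup_add_finrank_inf_eq (vectorSpan ℝ S) (Submodule.span ℝ {s})
  rw [hinf, finrank_bot, add_zero, ← hsup, finrank_span_singleton hs0] at this
  exact this

-- The direction space of `F` is the orthogonal complement of the linear span of the polar face.
-- That span has one dimension more than the polar face, which lies in an affine hyperplane missing
-- the origin.
open IsPolarPair in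
theorem IsPolarPair.finrank_vectorSpan_add [FiniteDimensional ℝ E] {A B F V : Set E}
    (h : IsPolarPair A B) (hV : V.Finite) (hVB : V ⊆ B)
    (hA : A = {y | ∀ v ∈ V, inner ℝ v y ≤ 1}) (hF : IsProperFace A B F) :
    Module.finrank ℝ (vectorSpan ℝ F) + Module.finrank ℝ (vectorSpan ℝ (polarFace B F)) + 1 =
      Module.finrank ℝ E := by
  obtain ⟨y₀, hy₀, heq⟩ := hF.exists_polarFace_eq h
  have horth : vectorSpan ℝ F = (Submodule.span ℝ (_root_.polarFace B F))ᗮ := by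
    refine le_antisymm ?_ fun u hu => ?_
    · rw [vectorSpan_def, Submodule.span_le]
      rintro _ ⟨a, ha, b, hb, rfl⟩
      refine (Submodule.mem_orthogonal' _ _).2 fun x hx => ?_
      induction hx using Submodule.span_induction with
      | mem x hx => simp only [vsub_eq_sub]; rw [inner_sub_left, hx.2 a ha, hx.2 b hb, sub_self]
      | zero => exact inner_zero_right _
      | add x y _ _ hx hy => rw [inner_add_right, hx, hy, add_zero]
      | smul c x _ hx => rw [real_inner_smul_right, hx, mul_zero]
    · have hu' : ∀ x ∈ _root_.polarFace B F, inner ℝ x u = 0 := fun x hx =>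
        (Submodule.mem_orthogonal _ u).1 hu x (Submodule.subset_span hx)
      have hev := hV.eventually_add_smul_mem hA (hF.subset hy₀) (u := u) fun v hv hvy =>
        hu' v (by rw [heq]; exact ⟨hVB hv, by rw [real_inner_comm]; exact hvy⟩)
      obtain ⟨ε, hε, hε0⟩ := ((hev.filter_mono nhdsWithin_le_nhds).and
        (self_mem_nhdsWithin : Set.Ioi (0 : ℝ) ∈ 𝓝[>] 0)).exists
      have hmem : y₀ + ε • u ∈ F := by
        rw [← hF.polarFace_polarFace]
        refine ⟨hε, fun x hx => ?_⟩
        rw [inner_add_right, real_inner_smul_right, hu' x hx, real_inner_comm, hx.2 y₀ hy₀]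
        simp
      have h1 := vsub_mem_vectorSpan ℝ hmem hy₀
      rw [vsub_eq_sub, add_sub_cancel_left] at h1
      exact (Submodule.smul_mem_iff _ (ne_of_gt hε0)).1 h1
  have h1 := finrank_span_eq_finrank_vectorSpan_add_one hF.nonempty_polarFace
    (y₀ := y₀) fun x hx => hx.2 y₀ hy₀
  have h2 := Submodule.finrank_add_finrank_orthogonal (Submodule.span ℝ (_root_.polarFace B F))
  rw [← horth] at h2
  omega

theorem vectorSpan_eq_top_of_mem_interior {A : Set E} {x : E} (hx : x ∈ interior A) :
    vectorSpan ℝ A = ⊤ := by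
  have h : affineSpan ℝ A = ⊤ := by
    rw [eq_top_iff, ← isOpen_interior.affineSpan_eq_top ⟨x, hx⟩]
    exact affineSpan_mono ℝ interior_subset
  rw [← direction_affineSpan, h, AffineSubspace.direction_top]

theorem IsPolarPair.isProperFace_of_mem_kFaces {d k : ℕ} {A B F : Set (EuclideanSpace ℝ (Fin d))}
    (h : IsPolarPair A B) (hk : k < d) (hF : F ∈ kFaces k A) : IsProperFace A B F := by
  refine h.isProperFace_of_isExposed hF.2.1 hF.1 ?_
  rintro rfl
  have := hF.2.2
  rw [vectorSpan_eq_top_of_mem_interior h.zero_mem_left] at this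
  simp at this
  omega

theorem IsPolarPair.faceNumber_eq {d k : ℕ} {A B V : Set (EuclideanSpace ℝ (Fin d))}
    (h : IsPolarPair A B) (hV : V.Finite) (hVB : V ⊆ B)
    (hA : A = {y | ∀ v ∈ V, inner ℝ v y ≤ 1}) (hk : k < d) :
    faceNumber k A = faceNumber (d - 1 - k) B := by
  have hinv : ∀ F ∈ kFaces k A, polarFace A (polarFace B F) = F := fun F hF =>
    (h.isProperFace_of_mem_kFaces hk hF).polarFace_polarFace
  have himage : kFaces (d - 1 - k) B = polarFace B '' kFaces k A := by
    ext G
    constructor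
    · intro hG
      have hG' := h.symm.isProperFace_of_mem_kFaces (by omega) hG
      have hF := hG'.polarFace h.symm
      -- The finite description is available for `A` only, so the dimension formula is applied to
      -- the polar of `G` rather than to `G`.
      have hdim := h.finrank_vectorSpan_add hV hVB hA hF
      rw [hG'.polarFace_polarFace, hG.2.2, finrank_euclideanSpace_fin] at hdim
      exact ⟨polarFace A G, ⟨hF.nonempty, hF.isExposed h, by omega⟩, hG'.polarFace_polarFace⟩
    · rintro ⟨F, hF, rfl⟩
      have hF' := h.isProperFace_of_mem_kFaces hk hF
      have hG := hF'.polarFace h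
      have hdim := h.finrank_vectorSpan_add hV hVB hA hF'
      rw [hF.2.2, finrank_euclideanSpace_fin] at hdim
      exact ⟨hG.nonempty, hG.isExposed h.symm, by omega⟩
  rw [faceNumber, faceNumber, himage, Set.InjOn.ncard_image]
  intro F hF F' hF' heq
  rw [← hinv F hF, heq, hinv F' hF']

/-- The bipolar theorem: a functional separating `x` from `B` is positive on its threshold because
`0 ∈ B`, and rescaling it gives a point of the polar. -/
theorem mem_of_forall_polar_inner_le_one [CompleteSpace E] {B : Set E} (hconv : Convex ℝ B)
    (hclosed : IsClosed B) (h0 : (0 : E) ∈ B) {x : E}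
    (hx : ∀ y, (∀ b ∈ B, inner ℝ b y ≤ 1) → inner ℝ y x ≤ 1) : x ∈ B := by
  by_contra hxB
  obtain ⟨f, u, hf, hu⟩ := geometric_hahn_banach_closed_point hconv hclosed hxB
  have hu0 : 0 < u := by simpa using hf 0 h0
  have hinner : ∀ b, inner ℝ (u⁻¹ • (InnerProductSpace.toDual ℝ E).symm f) b = u⁻¹ * f b :=
    fun b => by rw [real_inner_smul_left, InnerProductSpace.toDual_symm_apply]
  have h1 := hx (u⁻¹ • (InnerProductSpace.toDual ℝ E).symm f) fun b hb => by
    rw [real_inner_comm, hinner, inv_mul_le_one₀ hu0]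
    exact (hf b hb).le
  rw [hinner, inv_mul_le_one₀ hu0] at h1
  linarith

theorem IsPolarPair.of_isCompact [CompleteSpace E] {B : Set E} (hconv : Convex ℝ B)
    (hcomp : IsCompact B) (h0 : (0 : E) ∈ interior B) :
    IsPolarPair {y | ∀ x ∈ B, inner ℝ x y ≤ 1} B := by
  refine ⟨rfl, Set.Subset.antisymm (fun x hx y hy => ?_) fun x hx => ?_, ?_, h0⟩
  · rw [real_inner_comm]; exact hy x hx
  · exact mem_of_forall_polar_inner_le_one hconv hcomp.isClosed (interior_subset h0) hx
  · obtain ⟨R, hR0, hR⟩ := hcomp.isBounded.exists_pos_norm_le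
    rw [mem_interior_iff_mem_nhds]
    refine Filter.mem_of_superset (Metric.ball_mem_nhds 0 (inv_pos.2 hR0)) fun y hy x hx => ?_
    rw [mem_ball_zero_iff] at hy
    refine (real_inner_le_norm x y).trans ?_
    calc ‖x‖ * ‖y‖ ≤ R * R⁻¹ := mul_le_mul (hR x hx) hy.le (norm_nonneg y) hR0.le
      _ = 1 := mul_inv_cancel₀ hR0.ne'

theorem IsPolarPair.isBounded_left {A B : Set E} (h : IsPolarPair A B) :
    Bornology.IsBounded A := by
  obtain ⟨r, hr, hrB⟩ := Metric.mem_nhds_iff.1 (mem_interior_iff_mem_nhds.1 h.zero_mem_right)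
  refine isBounded_iff_forall_norm_le.2 ⟨2 / r, fun y hy => ?_⟩
  rcases eq_or_ne y 0 with rfl | hy0
  · simp; positivity
  have hn : 0 < ‖y‖ := norm_pos_iff.2 hy0
  have hmem : ((r / 2) * ‖y‖⁻¹) • y ∈ B := hrB (by
    rw [mem_ball_zero_iff, norm_smul, Real.norm_of_nonneg (by positivity), mul_assoc,
      inv_mul_cancel₀ hn.ne']
    linarith)
  have h1 := h.inner_le_one hy hmem
  rw [real_inner_smul_right, real_inner_self_eq_norm_sq] at h1
  have h2 : r / 2 * ‖y‖⁻¹ * ‖y‖ ^ 2 = r / 2 * ‖y‖ := by field_simp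
  rw [h2] at h1
  rw [le_div_iff₀ hr]
  linarith

/-- An extreme point is determined by its active constraints: if `y'` had the same ones as `y`,
small moves from `y` along both signs of `y' - y` would stay in `A`. -/
theorem Set.Finite.finite_extremePoints {V A : Set E} (hV : V.Finite)
    (hA : A = {y | ∀ v ∈ V, inner ℝ v y ≤ 1}) : (A.extremePoints ℝ).Finite := by
  refine Set.Finite.of_finite_image (f := fun y => {v ∈ V | inner ℝ v y = 1})
    (hV.finite_subsets.subset ?_) ?_
  · rintro _ ⟨y, -, rfl⟩
    exact Set.sep_subset _ _
  · intro y hy y' hy' heq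
    have hact : ∀ v ∈ V, inner ℝ v y = 1 → inner ℝ v (y' - y) = 0 := fun v hv hvy => by
      have : v ∈ {v ∈ V | inner ℝ v y' = 1} := (Set.ext_iff.1 heq v).1 ⟨hv, hvy⟩
      rw [inner_sub_right, this.2, hvy, sub_self]
    have hev := hV.eventually_add_smul_mem hA hy.1 hact
    have hev' := hV.eventually_add_smul_mem hA (u := -(y' - y)) hy.1 fun v hv hvy => by
      rw [inner_neg_right, hact v hv hvy, neg_zero]
    obtain ⟨ε, ⟨h1, h2⟩, hε0⟩ := (((hev.and hev').filter_mono nhdsWithin_le_nhds).and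
      (self_mem_nhdsWithin : Set.Ioi (0 : ℝ) ∈ 𝓝[>] 0)).exists
    have hε : ε ≠ 0 := ne_of_gt hε0
    have hseg : y ∈ openSegment ℝ (y + ε • (y' - y)) (y + ε • -(y' - y)) :=
      ⟨1 / 2, 1 / 2, by norm_num, by norm_num, by norm_num, by module⟩
    have h3 := hy.2 h1 h2 hseg
    rw [add_eq_left, smul_eq_zero, or_iff_right hε, sub_eq_zero] at h3
    exact h3.symm

theorem IsPolarPair.exists_eq_convexHull [FiniteDimensional ℝ E] {A B V : Set E}
    (h : IsPolarPair A B) (hV : V.Finite) (hA : A = {y | ∀ v ∈ V, inner ℝ v y ≤ 1}) :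
    ∃ S : Set E, S.Finite ∧ A = convexHull ℝ S := by
  have hfin := hV.finite_extremePoints hA
  have hclosed : IsClosed A := by
    rw [hA]
    simp only [Set.ofPred_forall]
    exact isClosed_biInter fun v _ => isClosed_le (by fun_prop) continuous_const
  have hcomp : IsCompact A := Metric.isCompact_of_isClosed_isBounded hclosed h.isBounded_left
  refine ⟨_, hfin, ?_⟩
  rw [← (hfin.isClosed_convexHull ℝ).closure_eq, closure_convexHull_extremePoints hcomp h.convex_left]

end Duality

/-! ### Limits of face number ratios, and families of distinct polytopes. -/

section CyclicFamilies

open Pointwise in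
theorem IsPolarDual.exists_isPolarPair {d : ℕ} {Q P : Set (EuclideanSpace ℝ (Fin d))}
    (hQ : IsDPolytope d Q) (h : IsPolarDual Q P) :
    ∃ (w : EuclideanSpace ℝ (Fin d)) (V : Set (EuclideanSpace ℝ (Fin d))), V.Finite ∧
      IsPolarPair P (w +ᵥ Q) ∧ V ⊆ w +ᵥ Q ∧ P = {y | ∀ v ∈ V, inner ℝ v y ≤ 1} := by
  obtain ⟨⟨S, hS, rfl⟩, -, -⟩ := hQ
  obtain ⟨z, hz, rfl⟩ := h
  have hP : {y | ∀ x ∈ convexHull ℝ S, inner ℝ (x - z) y ≤ 1} =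
      {y | ∀ x ∈ -z +ᵥ convexHull ℝ S, inner ℝ x y ≤ 1} := by
    ext y
    simp [Set.mem_vadd_set, neg_add_eq_sub]
  have hV : {y | ∀ x ∈ -z +ᵥ convexHull ℝ S, inner ℝ x y ≤ 1} =
      {y | ∀ v ∈ -z +ᵥ S, inner ℝ v y ≤ 1} := by
    ext y
    rw [← convexHull_vadd]
    refine ⟨fun hy v hv => hy v (subset_convexHull ℝ _ hv), fun hy x hx => ?_⟩
    have hsub : convexHull ℝ (-z +ᵥ S) ⊆ {x | innerSL ℝ y x ≤ 1} :=
      convexHull_min (fun v hv => by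
        simpa [real_inner_comm] using hy v hv)
        (convex_halfSpace_le (innerSL ℝ y).toLinearMap.isLinear 1)
    simpa [real_inner_comm] using hsub hx
  refine ⟨-z, -z +ᵥ S, hS.vadd_set, ?_, ?_, hP.trans hV⟩
  · rw [hP]
    refine IsPolarPair.of_isCompact ((convex_convexHull ℝ S).vadd _) ?_ ?_
    · rw [← convexHull_vadd]
      exact hS.vadd_set.isCompact_convexHull ℝ
    · rw [interior_vadd]
      exact ⟨z, hz, by simp⟩
  · exact Set.vadd_set_mono (subset_convexHull ℝ S)

theorem IsPolarDual.isDPolytope {d : ℕ} {Q P : Set (EuclideanSpace ℝ (Fin d))}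
    (hQ : IsDPolytope d Q) (h : IsPolarDual Q P) : IsDPolytope d P := by
  obtain ⟨w, V, hV, hpair, hVQ, hP⟩ := h.exists_isPolarPair hQ
  refine ⟨hpair.exists_eq_convexHull hV hP, ⟨0, interior_subset hpair.zero_mem_left⟩, ?_⟩
  rw [vectorSpan_eq_top_of_mem_interior hpair.zero_mem_left]
  simp

theorem IsPolarDual.faceNumber_eq {d k : ℕ} {Q P : Set (EuclideanSpace ℝ (Fin d))}
    (hQ : IsDPolytope d Q) (h : IsPolarDual Q P) (hk : k < d) :
    faceNumber k P = faceNumber (d - 1 - k) Q := by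
  obtain ⟨w, V, hV, hpair, hVQ, hP⟩ := h.exists_isPolarPair hQ
  rw [hpair.faceNumber_eq hV hVQ hP hk, faceNumber_vadd]

theorem IsDPolytope.exists_isPolarDual {d : ℕ} {Q : Set (EuclideanSpace ℝ (Fin d))}
    (hQ : IsDPolytope d Q) : ∃ P, IsPolarDual Q P := by
  obtain ⟨⟨S, -, rfl⟩, hne, hdim⟩ := hQ
  have htop : vectorSpan ℝ (convexHull ℝ S) = ⊤ :=
    Submodule.eq_top_of_finrank_eq (by rw [hdim, finrank_euclideanSpace_fin])
  obtain ⟨z, hz⟩ := ((convex_convexHull ℝ S).interior_nonempty_iff_affineSpan_eq_top).2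
    ((AffineSubspace.affineSpan_eq_top_iff_vectorSpan_eq_top_of_nonempty ℝ _ _ hne).2 htop)
  exact ⟨_, z, hz, rfl⟩

theorem rho_zero (d : ℕ) : rho d 0 = 1 := by
  norm_num [rho]

/-- This makes the denominators, the facet numbers of the cyclic polytopes, nonzero. -/
theorem eventually_card_blockSets_pos (d : ℕ) : ∀ᶠ n in atTop, 0 < (blockSets n d d).card := by
  have h := tendsto_card_blockSets_div_pow d d
  have hpos : (0 : ℝ) < blockCoeff d d * (1 / (d / 2).factorial) := by
    rw [blockCoeff_eq le_rfl, Nat.sub_self, rho_zero]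
    positivity
  filter_upwards [h.eventually_const_lt hpos] with n hn
  by_contra hcon
  rw [Nat.eq_zero_of_not_pos hcon] at hn
  simp at hn

theorem tendsto_card_blockSets_div_card {d j : ℕ} (hj : j ≤ d) :
    Tendsto (fun n => ((blockSets n d j).card : ℝ) / (blockSets n d d).card) atTop
      (𝓝 (rho d (d - j))) := by
  have hne : (blockCoeff d d * (1 / (d / 2).factorial) : ℝ) ≠ 0 := by
    rw [blockCoeff_eq le_rfl, Nat.sub_self, rho_zero]
    positivity
  have h := (tendsto_card_blockSets_div_pow d j).div (tendsto_card_blockSets_div_pow d d) hne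
  have hlim : (blockCoeff d j * (1 / (d / 2).factorial) : ℝ) /
      (blockCoeff d d * (1 / (d / 2).factorial)) = rho d (d - j) := by
    rw [blockCoeff_eq le_rfl, blockCoeff_eq hj, Nat.sub_self, rho_zero]
    have h1 : ((d / 2).factorial : ℝ) ≠ 0 := by positivity
    have h2 : (1 + (d % 2 : ℕ) : ℝ) ≠ 0 := by positivity
    field_simp
  rw [hlim] at h
  refine h.congr' ?_
  filter_upwards [eventually_gt_atTop 0] with n hn
  have : (n : ℝ) ^ (d / 2) ≠ 0 := by positivity
  simp only [Pi.div_apply]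
  rw [div_div_div_cancel_right₀ this]

/-- The cyclic polytope with parameters `0, …, n - 1`. -/
def integralCyclicPolytope (d n : ℕ) : Set (EuclideanSpace ℝ (Fin d)) :=
  momentHull d (fun i => (i : ℝ)) (Finset.range n)

theorem isCyclicPolytope_integralCyclicPolytope (d n : ℕ) :
    IsCyclicPolytope d n (integralCyclicPolytope d n) := by
  classical
  refine ⟨(Finset.range n).image (Nat.cast : ℕ → ℝ), ?_, ?_⟩
  · rw [Finset.card_image_of_injective _ Nat.cast_injective, Finset.card_range]
  · rw [integralCyclicPolytope, momentHull, Finset.coe_image, Set.image_image]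

theorem coord_mem_Icc_of_mem_integralCyclicPolytope {d n : ℕ} (hd : 0 < d)
    {x : EuclideanSpace ℝ (Fin d)} (hx : x ∈ integralCyclicPolytope d n) :
    x ⟨0, hd⟩ ∈ Set.Icc (0 : ℝ) (n - 1) := by
  have hsub : integralCyclicPolytope d n ⊆
      (EuclideanSpace.proj (𝕜 := ℝ) (⟨0, hd⟩ : Fin d)).toLinearMap ⁻¹' Set.Icc (0 : ℝ) (n - 1) := by
    refine convexHull_min ?_ ((convex_Icc _ _).linear_preimage _)
    rintro _ ⟨i, hi, rfl⟩
    have hi' : i + 1 ≤ n := by simpa using hi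
    have : (i : ℝ) + 1 ≤ n := by exact_mod_cast hi'
    have hval : (EuclideanSpace.proj (𝕜 := ℝ) (⟨0, hd⟩ : Fin d)).toLinearMap
        (momentCurve d (i : ℝ)) = i := by simp [momentCurve]
    rw [Set.mem_preimage, hval]
    exact ⟨Nat.cast_nonneg i, by linarith⟩
  simpa using hsub hx

-- The width in the first coordinate, `n - 1` for the parameters `0, …, n - 1`, does not change
-- under translation.
open Pointwise in
theorem le_of_vadd_integralCyclicPolytope_eq {d n n' : ℕ} (hd : 0 < d) (hn : 0 < n)
    {w w' : EuclideanSpace ℝ (Fin d)}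
    (h : w +ᵥ integralCyclicPolytope d n = w' +ᵥ integralCyclicPolytope d n') : n ≤ n' := by
  have key : ∀ i < n, ∃ a ∈ integralCyclicPolytope d n', w ⟨0, hd⟩ + i = w' ⟨0, hd⟩ + a ⟨0, hd⟩ := by
    intro i hi
    have hmem : w +ᵥ momentCurve d (i : ℝ) ∈ w' +ᵥ integralCyclicPolytope d n' := by
      rw [← h]
      exact Set.vadd_mem_vadd_set
        (momentCurve_mem_momentHull (t := fun i => (i : ℝ)) (Finset.mem_range.2 hi))
    obtain ⟨a, ha, hEq⟩ := hmem
    refine ⟨a, ha, ?_⟩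
    have := congrArg (fun x : EuclideanSpace ℝ (Fin d) => x ⟨0, hd⟩) hEq
    simp [momentCurve] at this
    exact this.symm
  obtain ⟨a, ha, h1⟩ := key (n - 1) (by omega)
  obtain ⟨b, hb, h2⟩ := key 0 hn
  have ha' := (coord_mem_Icc_of_mem_integralCyclicPolytope hd ha).2
  have hb' := (coord_mem_Icc_of_mem_integralCyclicPolytope hd hb).1
  rw [Nat.cast_pred hn] at h1
  rw [Nat.cast_zero] at h2
  have : (n : ℝ) ≤ n' := by linarith
  exact_mod_cast this

open Pointwise in
theorem eq_of_vadd_integralCyclicPolytope_eq {d n n' : ℕ} (hd : 0 < d) (hn : 0 < n) (hn' : 0 < n')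
    {w w' : EuclideanSpace ℝ (Fin d)}
    (h : w +ᵥ integralCyclicPolytope d n = w' +ᵥ integralCyclicPolytope d n') : n = n' :=
  le_antisymm (le_of_vadd_integralCyclicPolytope_eq hd hn h)
    (le_of_vadd_integralCyclicPolytope_eq hd hn' h.symm)

theorem exists_cyclicPolytope_families {d : ℕ} (hd : 0 < d) :
    ∃ P Q : ℕ → Set (EuclideanSpace ℝ (Fin d)), Set.InjOn P (Set.Ioi d) ∧ Set.InjOn Q (Set.Ioi d) ∧
      ∀ n, d < n → IsCyclicPolytope d n (Q n) ∧ IsPolarDual (Q n) (P n) := by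
  have hQ : ∀ n, d < n → IsDPolytope d (integralCyclicPolytope d n) := fun n hn =>
    (isCyclicPolytope_integralCyclicPolytope d n).isDPolytope hn
  have hex : ∀ n, ∃ P, d < n → IsPolarDual (integralCyclicPolytope d n) P := fun n => by
    rcases Nat.lt_or_ge d n with h | h
    · obtain ⟨P, hP⟩ := (hQ n h).exists_isPolarDual
      exact ⟨P, fun _ => hP⟩
    · exact ⟨∅, fun h' => absurd h' (by omega)⟩
  choose P hP using hex
  refine ⟨P, integralCyclicPolytope d, fun n hn n' hn' heq => ?_, fun n hn n' hn' heq => ?_,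
    fun n hn => ⟨isCyclicPolytope_integralCyclicPolytope d n, hP n hn⟩⟩
  · have hn1 : d < n := hn
    have hn2 : d < n' := hn'
    obtain ⟨w, -, -, hw, -⟩ := (hP n hn).exists_isPolarPair (hQ n hn)
    obtain ⟨w', -, -, hw', -⟩ := (hP n' hn').exists_isPolarPair (hQ n' hn')
    -- Equal duals have equal polars, and these are translates of the cyclic polytopes, possibly by
    -- different vectors; this is why the width comparison allows translations.
    refine eq_of_vadd_integralCyclicPolytope_eq hd (w := w) (w' := w') (by omega) (by omega) ?_
    rw [hw.right_eq, hw'.right_eq, heq]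
  · have hn1 : d < n := hn
    have hn2 : d < n' := hn'
    exact eq_of_vadd_integralCyclicPolytope_eq hd (w := 0) (w' := 0) (by omega) (by omega)
      (by rw [heq])

theorem le_of_tendsto_div_of_eventually_mul_le {a b : ℕ → ℕ} {c ρ : ℝ}
    (h : Tendsto (fun n => (a n : ℝ) / b n) atTop (𝓝 ρ)) (hb : ∀ᶠ n in atTop, 0 < b n)
    (hc : ∀ᶠ n in atTop, c * b n ≤ a n) : c ≤ ρ := by
  refine ge_of_tendsto h ?_
  filter_upwards [hb, hc] with n hbn hcn
  rwa [le_div_iff₀ (by exact_mod_cast hbn)]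

end CyclicFamilies

/-! ### The limits and the optimality of the constants. -/

theorem mainTheorem1 (d k : ℕ) (hd : 0 < d) (hk : k < d) :
    -- existence of the families
    (∃ P Q : ℕ → Set (EuclideanSpace ℝ (Fin d)),
      Set.InjOn P (Set.Ioi d) ∧ Set.InjOn Q (Set.Ioi d) ∧
      (∀ n, d < n → IsDPolytope d (P n) ∧ IsDPolytope d (Q n) ∧
        IsCyclicPolytope d n (Q n) ∧ IsPolarDual (Q n) (P n)) ∧
      Tendsto (fun n => (faceNumber k (P n) : ℝ) / (faceNumber 0 (P n) : ℝ))
        atTop (𝓝 (rho d k)) ∧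
      Tendsto (fun n => (faceNumber k (Q n) : ℝ) / (faceNumber (d - 1) (Q n) : ℝ))
        atTop (𝓝 (rho d (d - k - 1)))) ∧
    -- every choice of cyclic polytopes `Q n` and of polar duals `P n` will do
    (∀ P Q : ℕ → Set (EuclideanSpace ℝ (Fin d)),
      (∀ n, d < n → IsCyclicPolytope d n (Q n) ∧ IsPolarDual (Q n) (P n)) →
      (∀ n, d < n → IsDPolytope d (P n) ∧ IsDPolytope d (Q n)) ∧
      Tendsto (fun n => (faceNumber k (P n) : ℝ) / (faceNumber 0 (P n) : ℝ))
        atTop (𝓝 (rho d k)) ∧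
      Tendsto (fun n => (faceNumber k (Q n) : ℝ) / (faceNumber (d - 1) (Q n) : ℝ))
        atTop (𝓝 (rho d (d - k - 1)))) ∧
    -- the constants in the two linear lower bounds cannot be improved
    (∀ c : ℝ, (∀ P : Set (EuclideanSpace ℝ (Fin d)), IsDPolytope d P →
        c * (faceNumber 0 P : ℝ) ≤ (faceNumber k P : ℝ)) → c ≤ rho d k) ∧
    (∀ c : ℝ, (∀ P : Set (EuclideanSpace ℝ (Fin d)), IsDPolytope d P →
        c * (faceNumber (d - 1) P : ℝ) ≤ (faceNumber k P : ℝ)) → c ≤ rho d (d - k - 1)) := by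

  -- An `i`-face of the dual corresponds to a face of dimension `d - 1 - i` of the cyclic polytope,
  -- which has `d - i` vertices.
  have hP : ∀ P Q : ℕ → Set (EuclideanSpace ℝ (Fin d)),
      (∀ n, d < n → IsCyclicPolytope d n (Q n) ∧ IsPolarDual (Q n) (P n)) → ∀ n, d < n →
      ∀ i < d, faceNumber i (P n) = (blockSets n d (d - i)).card := by
    intro P Q h n hn i hi
    rw [(h n hn).2.faceNumber_eq ((h n hn).1.isDPolytope hn) hi,
      (h n hn).1.faceNumber_eq (by omega) hn]
    congr 2
    omega
  have hQ : ∀ P Q : ℕ → Set (EuclideanSpace ℝ (Fin d)),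
      (∀ n, d < n → IsCyclicPolytope d n (Q n) ∧ IsPolarDual (Q n) (P n)) → ∀ n, d < n →
      ∀ i < d, faceNumber i (Q n) = (blockSets n d (i + 1)).card := fun P Q h n hn i hi =>
    (h n hn).1.faceNumber_eq hi hn
  have hd1 : d - 1 + 1 = d := by omega
  have main : ∀ P Q : ℕ → Set (EuclideanSpace ℝ (Fin d)),
      (∀ n, d < n → IsCyclicPolytope d n (Q n) ∧ IsPolarDual (Q n) (P n)) →
      (∀ n, d < n → IsDPolytope d (P n) ∧ IsDPolytope d (Q n)) ∧
      Tendsto (fun n => (faceNumber k (P n) : ℝ) / (faceNumber 0 (P n) : ℝ))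
        atTop (𝓝 (rho d k)) ∧
      Tendsto (fun n => (faceNumber k (Q n) : ℝ) / (faceNumber (d - 1) (Q n) : ℝ))
        atTop (𝓝 (rho d (d - k - 1))) := by
    intro P Q h
    refine ⟨fun n hn => ?_, ?_, ?_⟩
    · have hQn := (h n hn).1.isDPolytope hn
      exact ⟨(h n hn).2.isDPolytope hQn, hQn⟩
    · have hlim := tendsto_card_blockSets_div_card (d := d) (j := d - k) (by omega)
      rw [Nat.sub_sub_self hk.le] at hlim
      refine hlim.congr' ?_
      filter_upwards [eventually_gt_atTop d] with n hn
      rw [hP P Q h n hn k hk, hP P Q h n hn 0 hd, Nat.sub_zero]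
    · have hlim := tendsto_card_blockSets_div_card (d := d) (j := k + 1) (by omega)
      rw [← Nat.sub_sub] at hlim
      refine hlim.congr' ?_
      filter_upwards [eventually_gt_atTop d] with n hn
      rw [hQ P Q h n hn k hk, hQ P Q h n hn (d - 1) (by omega), hd1]
  obtain ⟨P, Q, hPinj, hQinj, h⟩ := exists_cyclicPolytope_families hd
  obtain ⟨hpoly, hlimP, hlimQ⟩ := main P Q h
  refine ⟨⟨P, Q, hPinj, hQinj, fun n hn => ⟨(hpoly n hn).1, (hpoly n hn).2, h n hn⟩, hlimP, hlimQ⟩,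
    main, fun c hc => ?_, fun c hc => ?_⟩
  · refine le_of_tendsto_div_of_eventually_mul_le hlimP ?_ ?_
    · filter_upwards [eventually_gt_atTop d, eventually_card_blockSets_pos d] with n hn hpos
      rwa [hP P Q h n hn 0 hd, Nat.sub_zero]
    · filter_upwards [eventually_gt_atTop d] with n hn using hc _ (hpoly n hn).1
  · refine le_of_tendsto_div_of_eventually_mul_le hlimQ ?_ ?_
    · filter_upwards [eventually_gt_atTop d, eventually_card_blockSets_pos d] with n hn hpos
      rwa [hQ P Q h n hn (d - 1) (by omega), hd1]
    · filter_upwards [eventually_gt_atTop d] with n hn using hc _ (hpoly n hn).2
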